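/- Work in complex projective three-space. A \emph{dual pencil of quadrics} $\mathcal F$ is a two-dimensional linear system of symmetric $4\times 4$ matrices, regarded as quadratic equations in plane coordinates; a nonsingular quadric $\{x : x^{T}Mx=0\}$ belongs to $\mathcal F$ if its tangential matrix $M^{-1}$ does. ``Quadric'' means nonsingular quadric. A quadric $\Gamma$ \emph{touches} a line $\ell$ at a point $x\in\ell\cap\Gamma$ if $\ell$ lies in the tangent plane $T_x\Gamma$ but not on $\Gamma$; $T_x\Gamma$ is then the tangent plane corresponding to $\ell$. A \emph{configuration} for $\mathcal F$ consists of quadrics $\Gamma_0,\Gamma_1,\Gamma_2,\Gamma_3\in\mathcal F$ and four planes $\alpha,\beta,\gamma,\delta$ tangent to $\Gamma_0$, no three of them containing a common line, such that $\Gamma_1$ touches the lines $\alpha\beta$ and $\gamma\delta$, $\Gamma_2$ touches $\alpha\gamma$ and $\beta\delta$, $\Gamma_3$ touches $\alpha\delta$ and $\beta\gamma$ (where $\alpha\beta=\alpha\cap\beta$, etc.), and the six tangent planes corresponding to these six lines all belong to one pencil of planes, i.e. contain one line $\Delta$. It is \emph{general} if each of $\alpha,\beta,\gamma,\delta$ is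 tangent to no quadric of $\mathcal F$ other than $\Gamma_0$. \textbf{Theorem.} Let $\mathcal F$ be a dual pencil of quadrics. (1) If $\mathcal F$ contains no matrix of rank one, then every quadric $\Gamma_0\in\mathcal F$ occurs in some general configuration for $\mathcal F$. (2) In every configuration, the six lines $\alpha\beta,\gamma\delta,\alpha\gamma,\beta\delta,\alpha\delta,\beta\gamma$ belong to one bundle, i.e. pass through one point. (3) A general configuration is determined by any two of its six lines together with the tangent planes corresponding to them, in the following sense. (a) If two general configurations for $\mathcal F$ have the same two adjacent lines (lines in a common plane of the quadruple, such as $\alpha\beta$ and $\alpha\gamma$, at the same places) with the same corresponding tangent planes, then they have the same planes $\alpha,\beta,\gamma,\delta$ and the same quadrics $\Gamma_0,\Gamma_1,\Gamma_2,\Gamma_3$. (b) If two general configurations for $\mathcal F$ with the same $\Gamma_0$ have the same two opposite lines (such as $\alpha\beta$ and $\gamma\delta$, at the same places) with the same corresponding tangent planes, and these two tangent planes are distinct, then the configurations coincide up to interchanging the two planes through one or through both of the given lines, and relabelling $\Gamma_1,\Gamma_2,\Gamma_3$ accordingly. -/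

import Mathlib

/-- Homogeneous coordinates of complex projective three-space: points, lines and planes are the
linear subspaces of dimension one, two and three. -/
abbrev Coord : Type := Fin 4 → ℂ

/-- A nonsingular quadric surface `x ⬝ M x = 0`, given by its (symmetric, invertible) matrix. -/
structure Quadric where
  mat : Matrix (Fin 4) (Fin 4) ℂ
  symm : mat.IsSymm
  nonsing : mat.det ≠ 0

namespace Quadric

/-- Two matrices define the same quadric when they are proportional. -/
def Same (Γ Γ' : Quadric) : Prop := ∃ c : ℂ, c ≠ 0 ∧ Γ'.mat = c • Γ.mat

/-- The point with homogeneous coordinates `x` lies on the quadric. -/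
def Contains (Γ : Quadric) (x : Coord) : Prop := Matrix.toBilin' Γ.mat x x = 0

/-- The polar plane of `x`; for a point `x` of the quadric, the tangent plane at `x`. -/
noncomputable def tangentPlane (Γ : Quadric) (x : Coord) : Submodule ℂ Coord :=
  LinearMap.ker (Matrix.toBilin' Γ.mat x)

/-- The plane `π` is tangent to the quadric at some point. -/
def IsTangentPlane (Γ : Quadric) (π : Submodule ℂ Coord) : Prop :=
  ∃ x : Coord, x ≠ 0 ∧ Γ.Contains x ∧ π = Γ.tangentPlane x

/-- The quadric touches the line `l` at a point of `l`, and `τ` is its tangent plane at this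
point of tangency: `l` passes through the point `x` of the quadric, is contained in the tangent
plane `τ` at `x`, and does not lie on the quadric. -/
def Touches (Γ : Quadric) (l τ : Submodule ℂ Coord) : Prop :=
  ∃ x : Coord, x ≠ 0 ∧ x ∈ l ∧ Γ.Contains x ∧ τ = Γ.tangentPlane x ∧ l ≤ τ ∧
    ∃ y ∈ l, ¬ Γ.Contains y

end Quadric

/-- A dual pencil of quadrics: a two-dimensional linear system of symmetric matrices, regarded as
equations in plane coordinates. -/
structure DualPencil where
  forms : Submodule ℂ (Matrix (Fin 4) (Fin 4) ℂ)
  symm : ∀ B ∈ forms, B.IsSymm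
  dim : Module.finrank ℂ forms = 2

/-- The quadric with point equation `M` has tangential equation `M⁻¹`; it belongs to the dual
pencil when its tangential equation does. -/
def DualPencil.Has (F : DualPencil) (Γ : Quadric) : Prop := Γ.mat⁻¹ ∈ F.forms

/-- Four planes `α, β, γ, δ` (indexed by `0, 1, 2, 3`) and four quadrics `Γ₀, Γ₁, Γ₂, Γ₃`. -/
structure Config where
  plane : Fin 4 → Submodule ℂ Coord
  quadric : Fin 4 → Quadric

/-- The index of the quadric that has to touch the line of intersection of planes `i` and `j`:
`Γ₁` for `αβ, γδ`, `Γ₂` for `αγ, βδ`, `Γ₃` for `αδ, βγ` (the diagonal entries are `0`). -/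
def pairIndex (i j : Fin 4) : Fin 4 :=
  (!![0, 1, 2, 3; 1, 0, 3, 2; 2, 3, 0, 1; 3, 2, 1, 0] : Matrix (Fin 4) (Fin 4) (Fin 4)) i j

namespace Config

/-- The line of intersection of the planes `i` and `j`. -/
def line (c : Config) (i j : Fin 4) : Submodule ℂ Coord := c.plane i ⊓ c.plane j

/-- `τ` is the tangent plane, at the point of tangency with the line `i j`, of the quadric of the
configuration assigned to this line. -/
def IsContactPlane (c : Config) (i j : Fin 4) (τ : Submodule ℂ Coord) : Prop :=
  (c.quadric (pairIndex i j)).Touches (c.line i j) τ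

/-- The configurations of the theorem: the four quadrics belong to `F`; the four planes are tangent
to `Γ₀`, no three of them in one pencil; each quadric `Γ₁, Γ₂, Γ₃` touches its two lines of
intersection; the six tangent planes at the points of tangency belong to one pencil, with axis
`Δ`. -/
structure IsLebesgue (c : Config) (F : DualPencil) : Prop where
  mem : ∀ k, F.Has (c.quadric k)
  tangent : ∀ i, (c.quadric 0).IsTangentPlane (c.plane i)
  no_three : ∀ i j k, i ≠ j → i ≠ k → j ≠ k → ¬ c.line i j ≤ c.plane k
  contact : ∃ Δ : Submodule ℂ Coord, Module.finrank ℂ Δ = 2 ∧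
    ∀ i j, i ≠ j → ∃ τ, c.IsContactPlane i j τ ∧ Δ ≤ τ

/-- `Γ₀` is the only quadric of `F` that is tangent to any of the four planes. -/
def IsGeneral (c : Config) (F : DualPencil) : Prop :=
  ∀ i, ∀ Γ : Quadric, F.Has Γ → Γ.IsTangentPlane (c.plane i) → (c.quadric 0).Same Γ

end Config

/-! Everything is read in plane coordinates. The four planes become vectors `a i`, a quadric becomes
its tangential form, and touching the line of two planes means that this form has rank one on the
span of their vectors, with the contact plane as radical (`Quadric.touches_iff`). Six contact planes
through one axis become six vectors, one on each edge of the tetrahedron of the `a i`, in a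
two-dimensional space `D`.

Concurrence: no line meets all six edges of a nondegenerate tetrahedron, so the `a i` are dependent
and the four planes have a common point.

Uniqueness: let `A` be the form of Γ₀ and `B` a second member of the pencil. Generality gives `B (a
i) (a i) ≠ 0`, so this value can be scaled to 1. Rank one then leaves only signs, and `D` makes them
coherent (`IsGeneral.exists_normalized`): the contact vectors become `a i - a j`, and the quadric of
the edge is the member `B + s A` that takes the value 1 on `(a i, a j)`. Hence the `a i` lie in an
affine plane parallel to `D`, on the two conics `A = 0` and `B = 1`. Adjacent data fix three of
these points, and the conics fix the fourth (`coefficients_eq`). Opposite data fix two pairs up to a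
relative sign, which `D` excludes.

Existence reverses this. With `A u v = 1` for isotropic `u, v`, and `w` orthogonal to both with `A w
w = -2`, the vectors `w + x u + x⁻¹ v` run over a conic in `A = 0`. The condition `B = τ` is a
quartic in `x`; its four roots give the planes. The member `B + s A` belonging to a pair of roots
depends only on their product and is the same for the complementary pair, so three quadrics serve
six lines. What remains is genericity: distinct roots, and nonsingular quadrics. The rank hypothesis
enters in `exists_secant`, which provides `u` and `v`. -/

section

open Matrix Module

/-! ### Duality between planes and their coordinate vectors -/

/-- The subspace annihilated by `S` under the standard pairing of covectors and vectors. -/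
noncomputable def ann (S : Submodule ℂ Coord) : Submodule ℂ Coord :=
  (Matrix.toBilin' (1 : Matrix (Fin 4) (Fin 4) ℂ)).orthogonal S

theorem mem_ann {S : Submodule ℂ Coord} {x : Coord} : x ∈ ann S ↔ ∀ y ∈ S, y ⬝ᵥ x = 0 := by
  simp [ann, LinearMap.BilinForm.mem_orthogonal_iff, Matrix.toBilin'_apply']

theorem finrank_ann (S : Submodule ℂ Coord) : finrank ℂ (ann S) = 4 - finrank ℂ S := by
  unfold ann
  rw [LinearMap.BilinForm.finrank_orthogonal]
  · simp
  · rw [LinearMap.BilinForm.nondegenerate_toBilin'_iff_det_ne_zero]; simp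

theorem ann_ann (S : Submodule ℂ Coord) : ann (ann S) = S := by
  unfold ann
  rw [LinearMap.BilinForm.orthogonal_orthogonal]
  · rw [LinearMap.BilinForm.nondegenerate_toBilin'_iff_det_ne_zero]; simp
  · intro x y h
    simpa [Matrix.toBilin'_apply', dotProduct_comm] using h

/-- The plane with plane coordinates `a`. -/
noncomputable def planeOf (a : Coord) : Submodule ℂ Coord := ann (Submodule.span ℂ {a})

theorem mem_planeOf {a x : Coord} : x ∈ planeOf a ↔ a ⬝ᵥ x = 0 := by
  rw [planeOf, mem_ann]
  refine ⟨fun h => h a (Submodule.mem_span_singleton_self a), fun h y hy => ?_⟩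
  obtain ⟨c, rfl⟩ := Submodule.mem_span_singleton.1 hy
  simp [h]

theorem planeOf_smul {c : ℂ} (hc : c ≠ 0) (a : Coord) : planeOf (c • a) = planeOf a := by
  ext x; simp [mem_planeOf, hc]

theorem planeOf_inf_planeOf (a b : Coord) :
    planeOf a ⊓ planeOf b = ann (Submodule.span ℂ {a, b}) := by
  ext x
  rw [Submodule.mem_inf, mem_planeOf, mem_planeOf, mem_ann]
  refine ⟨fun h y hy => ?_, fun h => ⟨h a (Submodule.subset_span (by simp)),
    h b (Submodule.subset_span (by simp))⟩⟩
  obtain ⟨p, q, rfl⟩ := Submodule.mem_span_pair.1 hy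
  simp [h.1, h.2]

theorem ann_le_planeOf {S : Submodule ℂ Coord} {a : Coord} : ann S ≤ planeOf a ↔ a ∈ S := by
  constructor
  · intro h
    rw [← ann_ann S, mem_ann]
    intro y hy
    rw [dotProduct_comm]
    exact mem_planeOf.1 (h hy)
  · intro h x hx
    exact mem_planeOf.2 (mem_ann.1 hx a h)

theorem le_planeOf {S : Submodule ℂ Coord} {a : Coord} : S ≤ planeOf a ↔ a ∈ ann S := by
  conv_lhs => rw [← ann_ann S]
  exact ann_le_planeOf

theorem ann_injective : Function.Injective ann := fun S T h => by
  rw [← ann_ann S, h, ann_ann]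

theorem exists_smul_of_planeOf_eq {a b : Coord} (hb : b ≠ 0) (h : planeOf a = planeOf b) :
    ∃ c : ℂ, c ≠ 0 ∧ b = c • a := by
  have h1 : b ∈ Submodule.span ℂ {a} := by
    rw [← ann_le_planeOf]; exact h.le
  obtain ⟨c, rfl⟩ := Submodule.mem_span_singleton.1 h1
  exact ⟨c, fun hc => hb (by simp [hc]), rfl⟩

theorem toBilin'_symm {A : Matrix (Fin 4) (Fin 4) ℂ} (hA : A.IsSymm) (x y : Coord) :
    toBilin' A x y = toBilin' A y x := by
  rw [toBilin'_apply', toBilin'_apply', dotProduct_mulVec, dotProduct_comm, ← mulVec_transpose,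
    hA.eq]

theorem toBilin'_inv_mulVec {A : Matrix (Fin 4) (Fin 4) ℂ} (hA : A.IsSymm) (hd : A.det ≠ 0)
    (x y : Coord) : toBilin' A⁻¹ (A *ᵥ x) (A *ᵥ y) = toBilin' A x y := by
  rw [toBilin'_symm hA, toBilin'_apply', toBilin'_apply', mulVec_mulVec,
    nonsing_inv_mul _ (Ne.isUnit hd), one_mulVec, dotProduct_comm]

/-- The image of a totally isotropic subspace of dimension two under a nonsingular matrix is its
annihilator. -/
theorem map_eq_ann_of_isotropic {A : Matrix (Fin 4) (Fin 4) ℂ} (hd : A.det ≠ 0)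
    {S : Submodule ℂ Coord} (hS : finrank ℂ S = 2)
    (h : ∀ x ∈ S, ∀ y ∈ S, toBilin' A x y = 0) : S.map A.mulVecLin = ann S := by
  apply Submodule.eq_of_le_of_finrank_eq
  · rintro _ ⟨x, hx, rfl⟩
    rw [mem_ann]
    intro y hy
    have := h y hy x hx
    rwa [toBilin'_apply'] at this
  · rw [finrank_ann, hS]
    have : Function.Injective A.mulVecLin := by
      rw [Matrix.coe_mulVecLin, Matrix.mulVec_injective_iff_isUnit, Matrix.isUnit_iff_isUnit_det]
      exact Ne.isUnit hd
    rw [← (Submodule.equivMapOfInjective _ this S).finrank_eq, hS]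

/-! ### Tangential forms and contact with lines -/

namespace Quadric

/-- The tangential form of a quadric, a bilinear form on plane coordinates. -/
noncomputable def dual (Γ : Quadric) : LinearMap.BilinForm ℂ Coord := toBilin' Γ.mat⁻¹

theorem inv_symm (Γ : Quadric) : Γ.mat⁻¹.IsSymm := by
  unfold Matrix.IsSymm
  rw [transpose_nonsing_inv, Γ.symm.eq]

theorem inv_det (Γ : Quadric) : Γ.mat⁻¹.det ≠ 0 := by
  rw [det_nonsing_inv]
  simpa using Γ.nonsing

theorem mul_inv (Γ : Quadric) : Γ.mat * Γ.mat⁻¹ = 1 := mul_nonsing_inv _ (Ne.isUnit Γ.nonsing)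

theorem inv_mul (Γ : Quadric) : Γ.mat⁻¹ * Γ.mat = 1 := nonsing_inv_mul _ (Ne.isUnit Γ.nonsing)

theorem dual_symm (Γ : Quadric) (x y : Coord) : Γ.dual x y = Γ.dual y x :=
  toBilin'_symm Γ.inv_symm x y

theorem dual_mulVec (Γ : Quadric) (x y : Coord) :
    Γ.dual (Γ.mat *ᵥ x) (Γ.mat *ᵥ y) = toBilin' Γ.mat x y :=
  toBilin'_inv_mulVec Γ.symm Γ.nonsing x y

theorem mat_mulVec_inv (Γ : Quadric) (a : Coord) : Γ.mat *ᵥ (Γ.mat⁻¹ *ᵥ a) = a := by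
  rw [mulVec_mulVec, Γ.mul_inv, one_mulVec]

theorem inv_mulVec_mat (Γ : Quadric) (a : Coord) : Γ.mat⁻¹ *ᵥ (Γ.mat *ᵥ a) = a := by
  rw [mulVec_mulVec, Γ.inv_mul, one_mulVec]

theorem tangentPlane_eq (Γ : Quadric) (x : Coord) : Γ.tangentPlane x = planeOf (Γ.mat *ᵥ x) := by
  ext y
  rw [tangentPlane, LinearMap.mem_ker, mem_planeOf, toBilin'_symm Γ.symm, toBilin'_apply',
    dotProduct_comm]

theorem dual_apply (Γ : Quadric) (a b : Coord) : Γ.dual a b = a ⬝ᵥ Γ.mat⁻¹ *ᵥ b :=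
  toBilin'_apply' _ _ _

theorem isTangentPlane_iff (Γ : Quadric) (π : Submodule ℂ Coord) :
    Γ.IsTangentPlane π ↔ ∃ a : Coord, a ≠ 0 ∧ π = planeOf a ∧ Γ.dual a a = 0 := by
  constructor
  · rintro ⟨x, hx, hc, rfl⟩
    refine ⟨Γ.mat *ᵥ x, fun h => hx ?_, Γ.tangentPlane_eq x, ?_⟩
    · rw [← Γ.inv_mulVec_mat x, h, mulVec_zero]
    · rw [dual_mulVec]; exact hc
  · rintro ⟨a, ha, rfl, h⟩
    refine ⟨Γ.mat⁻¹ *ᵥ a, fun h => ha ?_, ?_, ?_⟩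
    · rw [← Γ.mat_mulVec_inv a, h, mulVec_zero]
    · rw [Contains, ← dual_mulVec, mat_mulVec_inv]; exact h
    · rw [tangentPlane_eq, mat_mulVec_inv]

theorem isTangentPlane_planeOf (Γ : Quadric) {a : Coord} (ha : a ≠ 0) :
    Γ.IsTangentPlane (planeOf a) ↔ Γ.dual a a = 0 := by
  rw [isTangentPlane_iff]
  constructor
  · rintro ⟨b, hb, h, h'⟩
    obtain ⟨c, hc, rfl⟩ := exists_smul_of_planeOf_eq hb h
    simpa [hc] using h'
  · exact fun h => ⟨a, ha, rfl, h⟩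

/-- A quadric touches a line exactly when the tangential form is of rank one on the pencil of
planes through the line; the contact plane is the radical. -/
theorem touches_iff (Γ : Quadric) {a b : Coord} (hab : LinearIndependent ℂ ![a, b])
    (τ : Submodule ℂ Coord) :
    Γ.Touches (planeOf a ⊓ planeOf b) τ ↔ ∃ p q : ℂ, p • a + q • b ≠ 0 ∧
      τ = planeOf (p • a + q • b) ∧ Γ.dual a (p • a + q • b) = 0 ∧
      Γ.dual b (p • a + q • b) = 0 ∧ ¬ (Γ.dual a a = 0 ∧ Γ.dual b b = 0 ∧ Γ.dual a b = 0) := by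
  have hS : finrank ℂ (Submodule.span ℂ {a, b}) = 2 := by
    have := finrank_span_eq_card hab
    rwa [Matrix.range_cons_cons_empty] at this
  have hl : finrank ℂ (ann (Submodule.span ℂ {a, b})) = 2 := by rw [finrank_ann, hS]
  rw [planeOf_inf_planeOf]
  constructor
  · rintro ⟨x, hx, hxl, hc, rfl, hle, y, hy, hyc⟩
    rw [tangentPlane_eq, ann_le_planeOf, Submodule.mem_span_pair] at hle
    obtain ⟨p, q, hpq⟩ := hle
    refine ⟨p, q, ?_, ?_, ?_, ?_, ?_⟩
    · intro h
      apply hx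
      rw [← Γ.inv_mulVec_mat x, ← hpq, h, mulVec_zero]
    · rw [tangentPlane_eq, hpq]
    · rw [hpq, dual_apply, inv_mulVec_mat]
      exact mem_ann.1 hxl a (Submodule.subset_span (by simp))
    · rw [hpq, dual_apply, inv_mulVec_mat]
      exact mem_ann.1 hxl b (Submodule.subset_span (by simp))
    -- A tangential form vanishing on the whole pencil of planes would carry that pencil onto the
    -- points of its axis, which would then lie on the quadric.
    · rintro ⟨haa, hbb, hba⟩
      have := map_eq_ann_of_isotropic Γ.inv_det hS (by
        intro x hx y hy
        obtain ⟨p, q, rfl⟩ := Submodule.mem_span_pair.1 hx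
        obtain ⟨r, s, rfl⟩ := Submodule.mem_span_pair.1 hy
        change Γ.dual _ _ = 0
        simp [haa, hbb, hba, Γ.dual_symm b a])
      rw [← this] at hy
      obtain ⟨z, hz, rfl⟩ := hy
      obtain ⟨p, q, rfl⟩ := Submodule.mem_span_pair.1 hz
      apply hyc
      rw [Contains, ← dual_mulVec, mulVecLin_apply, mat_mulVec_inv]
      simp [haa, hbb, hba, Γ.dual_symm b a]
  · rintro ⟨p, q, h0, rfl, h1, h2, h3⟩
    set t := p • a + q • b with ht
    refine ⟨Γ.mat⁻¹ *ᵥ t, fun h => h0 ?_, ?_, ?_, ?_, ?_, ?_⟩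
    · rw [← Γ.mat_mulVec_inv t, h, mulVec_zero]
    · rw [mem_ann]
      intro y hy
      obtain ⟨r, s, rfl⟩ := Submodule.mem_span_pair.1 hy
      rw [← dual_apply]
      simp [h1, h2]
    · rw [Contains, ← dual_mulVec, mat_mulVec_inv]
      have : Γ.dual t t = p * Γ.dual a t + q * Γ.dual b t := by
        conv_lhs => rw [ht, LinearMap.map_add₂, LinearMap.map_smul₂, LinearMap.map_smul₂, ← ht]
        simp
      rw [this, h1, h2]; simp
    · rw [tangentPlane_eq, mat_mulVec_inv]
    · rw [ann_le_planeOf]; exact Submodule.mem_span_pair.2 ⟨p, q, rfl⟩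
    -- Conversely, a line lying on the quadric is totally isotropic by polarization, and the
    -- tangential form then vanishes on all planes through it.
    · by_contra! hcon
      have hiso : ∀ x ∈ ann (Submodule.span ℂ {a, b}), ∀ y ∈ ann (Submodule.span ℂ {a, b}),
          toBilin' Γ.mat x y = 0 := by
        intro x hx y hy
        have e1 := hcon _ (add_mem hx hy)
        have e2 := hcon _ hx
        have e3 := hcon _ hy
        simp only [Contains, map_add, LinearMap.add_apply] at e1 e2 e3
        rw [toBilin'_symm Γ.symm y x] at e1
        linear_combination (1 / 2 : ℂ) * (e1 - e2 - e3)
      have := map_eq_ann_of_isotropic Γ.nonsing hl hiso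
      rw [ann_ann] at this
      have hz : ∀ z ∈ Submodule.span ℂ {a, b}, ∀ z' ∈ Submodule.span ℂ {a, b},
          Γ.dual z z' = 0 := by
        intro z hz z' hz'
        rw [← this] at hz hz'
        obtain ⟨x, hx, rfl⟩ := hz
        obtain ⟨y, hy, rfl⟩ := hz'
        rw [mulVecLin_apply, mulVecLin_apply, dual_mulVec]
        exact hiso x hx y hy
      have ha : a ∈ Submodule.span ℂ {a, b} := Submodule.subset_span (by simp)
      have hb : b ∈ Submodule.span ℂ {a, b} := Submodule.subset_span (by simp)
      exact h3 ⟨hz a ha a ha, hz b hb b hb, hz a ha b hb⟩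

/-- The quadric with a given nonsingular tangential matrix. -/
noncomputable def ofDual (A : Matrix (Fin 4) (Fin 4) ℂ) (hA : A.IsSymm) (hd : A.det ≠ 0) :
    Quadric where
  mat := A⁻¹
  symm := by
    unfold Matrix.IsSymm
    rw [transpose_nonsing_inv, hA.eq]
  nonsing := by
    rw [det_nonsing_inv]
    simpa using hd

theorem ofDual_inv (A : Matrix (Fin 4) (Fin 4) ℂ) (hA : A.IsSymm) (hd : A.det ≠ 0) :
    (ofDual A hA hd).mat⁻¹ = A := nonsing_inv_nonsing_inv _ (Ne.isUnit hd)

theorem same_iff (Γ Γ' : Quadric) : Γ.Same Γ' ↔ ∃ c : ℂ, c ≠ 0 ∧ Γ'.mat⁻¹ = c • Γ.mat⁻¹ := by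
  have key : ∀ (A B : Matrix (Fin 4) (Fin 4) ℂ) (c : ℂ), A.det ≠ 0 → c ≠ 0 → B = c • A →
      B⁻¹ = c⁻¹ • A⁻¹ := by
    rintro A B c hA hc rfl
    apply inv_eq_left_inv
    rw [smul_mul_smul_comm, inv_mul_cancel₀ hc, one_smul, nonsing_inv_mul _ (Ne.isUnit hA)]
  constructor
  · rintro ⟨c, hc, h⟩
    exact ⟨c⁻¹, inv_ne_zero hc, key _ _ c Γ.nonsing hc h⟩
  · rintro ⟨c, hc, h⟩
    refine ⟨c⁻¹, inv_ne_zero hc, ?_⟩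
    have := key _ _ c Γ.inv_det hc h
    rwa [nonsing_inv_nonsing_inv _ (Ne.isUnit Γ.nonsing),
      nonsing_inv_nonsing_inv _ (Ne.isUnit Γ'.nonsing)] at this

end Quadric

/-! ### Concurrence of the six lines -/

theorem exists_combination_of_mem {D : Submodule ℂ Coord} (hD : finrank ℂ D = 2) {x y z : Coord}
    (hx : x ∈ D) (hy : y ∈ D) (hz : z ∈ D) (h : ∀ p q : ℂ, p • x + q • y = 0 → p = 0 ∧ q = 0) :
    ∃ p q : ℂ, p • x + q • y = z := by
  have hli : LinearIndependent ℂ ![x, y] := LinearIndependent.pair_iff.2 h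
  have h1 := finrank_span_eq_card hli
  rw [Matrix.range_cons_cons_empty] at h1
  have : Submodule.span ℂ {x, y} = D :=
    Submodule.eq_of_le_of_finrank_eq (Submodule.span_le.2 (by
      rintro _ (rfl | rfl)
      exacts [hx, hy])) (by rw [h1, hD]; rfl)
  rw [← this] at hz
  exact Submodule.mem_span_pair.1 hz

/-- A line does not meet all six edges of a tetrahedron. -/
theorem not_linearIndependent_of_edges {D : Submodule ℂ Coord} (hD : finrank ℂ D = 2)
    {a : Fin 4 → Coord}
    (h : ∀ i j, i ≠ j → ∃ p q : ℂ, p • a i + q • a j ≠ 0 ∧ p • a i + q • a j ∈ D) :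
    ¬ LinearIndependent ℂ a := by
  intro hli
  let b : Basis (Fin 4) ℂ Coord := basisOfLinearIndependentOfCardEqFinrank hli (by simp)
  have hb : ∀ i, b i = a i := fun i => by simp [b]
  obtain ⟨f, hf⟩ : ∃ f : Fin 4 → Coord →ₗ[ℂ] ℂ, f = b.coord := ⟨_, rfl⟩
  have hc : ∀ i j, f i (a j) = if i = j then 1 else 0 := by
    intro i j
    rw [hf, ← hb j, Basis.coord_apply, Basis.repr_self, Finsupp.single_apply]
    simp [eq_comm]
  -- If `D` left the plane of the face opposite `l`, it would meet that plane in a single point.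
  -- This point would lie on all three edges of the face, which have no common point. So `D` lies in
  -- every face, and the four faces have zero intersection.
  have face : ∀ i j k l : Fin 4, i ≠ j → i ≠ k → i ≠ l → j ≠ k → j ≠ l → k ≠ l →
      ∀ d ∈ D, f l d = 0 := by
    intro i j k l hij hik hil hjk hjl hkl d hd
    by_contra hne
    obtain ⟨p, q, hT, hTD⟩ := h i j hij
    obtain ⟨p', q', hT', hTD'⟩ := h i k hik
    obtain ⟨p'', q'', hT'', hTD''⟩ := h j k hjk
    have hl : f l (p • a i + q • a j) = 0 := by simp [hc, hil.symm, hjl.symm]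
    have hind : ∀ r s : ℂ, r • d + s • (p • a i + q • a j) = 0 → r = 0 ∧ s = 0 := by
      intro r s hrs
      have h1 := congrArg (f l) hrs
      rw [map_add, map_smul, map_smul, hl] at h1
      have hr : r = 0 := by simpa [hne] using h1
      subst hr
      rw [zero_smul, zero_add] at hrs
      exact ⟨rfl, (smul_eq_zero.1 hrs).resolve_right hT⟩
    obtain ⟨r, s, hrs⟩ := exists_combination_of_mem hD hd hTD hTD' hind
    obtain ⟨r', s', hrs'⟩ := exists_combination_of_mem hD hd hTD hTD'' hind
    have hr : r = 0 := by
      have h1 := congrArg (f l) hrs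
      rw [map_add, map_smul, map_smul, hl] at h1
      simpa [hc, hil.symm, hkl.symm, hne] using h1
    have hr' : r' = 0 := by
      have h1 := congrArg (f l) hrs'
      rw [map_add, map_smul, map_smul, hl] at h1
      simpa [hc, hjl.symm, hkl.symm, hne] using h1
    subst hr hr'
    rw [zero_smul, zero_add] at hrs hrs'
    have hs : s ≠ 0 := by
      rintro rfl
      exact hT' (by rw [← hrs, zero_smul])
    have hs' : s' ≠ 0 := by
      rintro rfl
      exact hT'' (by rw [← hrs', zero_smul])
    have hq : q = 0 := by
      have h1 := congrArg (f j) hrs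
      simpa [hc, hij.symm, hjk, hs] using h1
    have hp : p = 0 := by
      have h1 := congrArg (f i) hrs'
      simpa [hc, hij, hik, hs'] using h1
    exact hT (by simp [hp, hq])
  have hbot : D = ⊥ := by
    rw [Submodule.eq_bot_iff]
    intro d hd
    apply b.ext_elem
    intro l
    rw [map_zero, Finsupp.zero_apply, ← Basis.coord_apply, ← hf]
    fin_cases l
    · exact face 1 2 3 0 (by decide) (by decide) (by decide) (by decide) (by decide) (by decide) d hd
    · exact face 0 2 3 1 (by decide) (by decide) (by decide) (by decide) (by decide) (by decide) d hd
    · exact face 0 1 3 2 (by decide) (by decide) (by decide) (by decide) (by decide) (by decide) d hd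
    · exact face 0 1 2 3 (by decide) (by decide) (by decide) (by decide) (by decide) (by decide) d hd
  rw [hbot] at hD
  simp at hD

namespace Config

/-- Plane coordinates `a` of the four planes of a configuration, all tangent to `Γ₀`, any three of
them independent. -/
structure HasCoords (c : Config) (a : Fin 4 → Coord) : Prop where
  plane : ∀ i, c.plane i = planeOf (a i)
  indep : ∀ i j k, i ≠ j → i ≠ k → j ≠ k → ∀ p q r : ℂ,
    p • a i + q • a j + r • a k = 0 → p = 0 ∧ q = 0 ∧ r = 0
  tangent : ∀ i, (c.quadric 0).dual (a i) (a i) = 0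

theorem exists_third (i j : Fin 4) : ∃ k, i ≠ k ∧ j ≠ k := by
  revert i j; decide

namespace HasCoords

variable {c : Config} {a : Fin 4 → Coord}

theorem indep_pair (h : c.HasCoords a) {i j : Fin 4} (hij : i ≠ j) (p q : ℂ)
    (hpq : p • a i + q • a j = 0) : p = 0 ∧ q = 0 := by
  obtain ⟨k, hik, hjk⟩ := exists_third i j
  have := h.indep i j k hij hik hjk p q 0 (by simpa using hpq)
  exact ⟨this.1, this.2.1⟩

theorem ne_zero (h : c.HasCoords a) (i : Fin 4) : a i ≠ 0 := by
  intro h0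
  obtain ⟨k, hik, -⟩ := exists_third i i
  have := h.indep_pair hik 1 0 (by simp [h0])
  simp at this

theorem linearIndependent_pair (h : c.HasCoords a) {i j : Fin 4} (hij : i ≠ j) :
    LinearIndependent ℂ ![a i, a j] :=
  LinearIndependent.pair_iff.2 (h.indep_pair hij)

theorem line_eq (h : c.HasCoords a) (i j : Fin 4) :
    c.line i j = planeOf (a i) ⊓ planeOf (a j) := by
  rw [Config.line, h.plane, h.plane]

theorem isContactPlane_iff (h : c.HasCoords a) {i j : Fin 4} (hij : i ≠ j)
    (τ : Submodule ℂ Coord) :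
    c.IsContactPlane i j τ ↔ ∃ p q : ℂ, p • a i + q • a j ≠ 0 ∧ τ = planeOf (p • a i + q • a j) ∧
      (c.quadric (pairIndex i j)).dual (a i) (p • a i + q • a j) = 0 ∧
      (c.quadric (pairIndex i j)).dual (a j) (p • a i + q • a j) = 0 ∧
      ¬ ((c.quadric (pairIndex i j)).dual (a i) (a i) = 0 ∧
        (c.quadric (pairIndex i j)).dual (a j) (a j) = 0 ∧
        (c.quadric (pairIndex i j)).dual (a i) (a j) = 0) := by
  rw [IsContactPlane, h.line_eq]
  exact Quadric.touches_iff _ (h.linearIndependent_pair hij) τ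

/-- Rescaled plane coordinates. -/
theorem smul (h : c.HasCoords a) {e : Fin 4 → ℂ} (he : ∀ i, e i ≠ 0) :
    c.HasCoords (fun i => e i • a i) where
  plane i := by rw [planeOf_smul (he i), h.plane]
  indep i j k hij hik hjk p q r hpqr := by
    simp only [smul_smul] at hpqr
    simpa [he] using h.indep i j k hij hik hjk _ _ _ hpqr
  tangent i := by simp [h.tangent i]

end HasCoords

namespace IsLebesgue

variable {c : Config} {F : DualPencil}

theorem exists_hasCoords (hc : c.IsLebesgue F) : ∃ a, c.HasCoords a := by
  have := fun i => ((c.quadric 0).isTangentPlane_iff (c.plane i)).1 (hc.tangent i)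
  choose a ha0 hpl ht using this
  refine ⟨a, hpl, ?_, ht⟩
  have key : ∀ i j k, i ≠ j → i ≠ k → j ≠ k → ∀ p q r : ℂ,
      p • a i + q • a j + r • a k = 0 → r = 0 := by
    intro i j k hij hik hjk p q r h
    by_contra hr
    apply hc.no_three i j k hij hik hjk
    rw [line, hpl, hpl, hpl, planeOf_inf_planeOf, ann_le_planeOf, Submodule.mem_span_pair]
    refine ⟨-r⁻¹ * p, -r⁻¹ * q, ?_⟩
    have := congrArg (fun x => r⁻¹ • x) h
    simp only [smul_add, smul_smul, inv_mul_cancel₀ hr, one_smul, smul_zero] at this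
    rw [← sub_eq_zero, ← neg_eq_zero, ← this]
    module
  intro i j k hij hik hjk p q r h
  refine ⟨key j k i hjk hij.symm hik.symm q r p ?_, key i k j hik hij hjk.symm p r q ?_,
    key i j k hij hik hjk p q r h⟩ <;> rw [← h] <;> abel

theorem exists_axis (hc : c.IsLebesgue F) {a : Fin 4 → Coord} (h : c.HasCoords a) :
    ∃ D : Submodule ℂ Coord, finrank ℂ D = 2 ∧ ∀ i j, i ≠ j → ∃ p q : ℂ,
      p • a i + q • a j ≠ 0 ∧ p • a i + q • a j ∈ D ∧
      (c.quadric (pairIndex i j)).dual (a i) (p • a i + q • a j) = 0 ∧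
      (c.quadric (pairIndex i j)).dual (a j) (p • a i + q • a j) = 0 ∧
      ¬ ((c.quadric (pairIndex i j)).dual (a i) (a i) = 0 ∧
        (c.quadric (pairIndex i j)).dual (a j) (a j) = 0 ∧
        (c.quadric (pairIndex i j)).dual (a i) (a j) = 0) := by
  obtain ⟨Δ, hΔ, hcon⟩ := hc.contact
  refine ⟨ann Δ, by rw [finrank_ann, hΔ], fun i j hij => ?_⟩
  obtain ⟨τ, hτ, hle⟩ := hcon i j hij
  obtain ⟨p, q, h0, rfl, h1, h2, h3⟩ := (h.isContactPlane_iff hij τ).1 hτ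
  exact ⟨p, q, h0, le_planeOf.1 hle, h1, h2, h3⟩

theorem not_linearIndependent (hc : c.IsLebesgue F) {a : Fin 4 → Coord} (h : c.HasCoords a) :
    ¬ LinearIndependent ℂ a := by
  obtain ⟨D, hD, hcon⟩ := hc.exists_axis h
  refine not_linearIndependent_of_edges hD fun i j hij => ?_
  obtain ⟨p, q, h0, h1, -⟩ := hcon i j hij
  exact ⟨p, q, h0, h1⟩

/-- The six lines of a configuration pass through one point. -/
theorem exists_common_point (hc : c.IsLebesgue F) :
    ∃ x : Coord, x ≠ 0 ∧ ∀ i j, i ≠ j → x ∈ c.line i j := by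
  obtain ⟨a, ha⟩ := hc.exists_hasCoords
  have hdet : (Matrix.of a).det = 0 :=
    det_eq_zero_of_not_linearIndependent_rows (hc.not_linearIndependent ha)
  obtain ⟨x, hx, hx0⟩ := exists_mulVec_eq_zero_iff.2 hdet
  refine ⟨x, hx, fun i j _ => ?_⟩
  have : ∀ i, x ∈ planeOf (a i) := fun i => mem_planeOf.2 (congrFun hx0 i)
  rw [ha.line_eq]
  exact ⟨this i, this j⟩

end IsLebesgue

end Config

/-! ### Bases of the pencil and nondegeneracy -/

namespace DualPencil

variable {F : DualPencil}

theorem exists_not_mem_span (F : DualPencil) (A : Matrix (Fin 4) (Fin 4) ℂ) :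
    ∃ B ∈ F.forms, B ∉ Submodule.span ℂ {A} := by
  by_contra! h
  have h1 := Submodule.finrank_mono (show F.forms ≤ Submodule.span ℂ {A} from h)
  have h2 := finrank_span_le_card (R := ℂ) {A}
  simp only [Set.toFinset_singleton, Finset.card_singleton] at h2
  rw [F.dim] at h1
  omega

theorem exists_combination {A B : Matrix (Fin 4) (Fin 4) ℂ} (hA : A ∈ F.forms) (hB : B ∈ F.forms)
    (hA0 : A ≠ 0) (hBA : B ∉ Submodule.span ℂ {A}) {C : Matrix (Fin 4) (Fin 4) ℂ}
    (hC : C ∈ F.forms) : ∃ x y : ℂ, C = x • B + y • A := by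
  have hli : LinearIndependent ℂ ![A, B] := by
    rw [LinearIndependent.pair_iff' hA0]
    exact fun r hr => hBA (Submodule.mem_span_singleton.2 ⟨r, hr⟩)
  have h1 := finrank_span_eq_card hli
  rw [Matrix.range_cons_cons_empty] at h1
  have : Submodule.span ℂ {A, B} = F.forms :=
    Submodule.eq_of_le_of_finrank_eq (Submodule.span_le.2 (by
      rintro _ (rfl | rfl)
      exacts [hA, hB])) (by rw [h1, F.dim]; rfl)
  rw [← this] at hC
  obtain ⟨y, x, h⟩ := Submodule.mem_span_pair.1 hC
  exact ⟨x, y, by rw [← h, add_comm]⟩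

end DualPencil

theorem Quadric.inv_ne_zero (Γ : Quadric) : Γ.mat⁻¹ ≠ 0 := fun h => Γ.inv_det (by simp [h])

theorem exists_det_add_smul_ne_zero {A : Matrix (Fin 4) (Fin 4) ℂ} (hA : A.det ≠ 0)
    (B : Matrix (Fin 4) (Fin 4) ℂ) : ∃ ε : ℂ, ε ≠ 0 ∧ (A + ε • B).det ≠ 0 := by
  have hcont : Continuous fun ε : ℂ => (A + ε • B).det := by fun_prop
  have h1 : ∀ᶠ ε in nhds (0 : ℂ), (A + ε • B).det ≠ 0 :=
    hcont.continuousAt.eventually_ne (by simpa using hA)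
  have h2 := (h1.filter_mono nhdsWithin_le_nhds).and
    (self_mem_nhdsWithin : {(0 : ℂ)}ᶜ ∈ nhdsWithin 0 {0}ᶜ)
  obtain ⟨ε, h, h0⟩ := h2.exists
  exact ⟨ε, h0, h⟩

/-- A nonsingular form on plane coordinates has no constant Gram matrix on three independent
vectors. -/
theorem Quadric.gram_not_constant (Γ : Quadric) {a b c : Coord}
    (h : ∀ p q r : ℂ, p • a + q • b + r • c = 0 → p = 0 ∧ q = 0 ∧ r = 0)
    (hab : Γ.dual a (a - b) = 0) (hac : Γ.dual a (a - c) = 0)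
    (hbb : Γ.dual b (a - b) = 0) (hbc : Γ.dual b (a - c) = 0)
    (hcb : Γ.dual c (a - b) = 0) (hcc : Γ.dual c (a - c) = 0) : False := by
  have hli : LinearIndependent ℂ ![a, b, c] := by
    rw [Fintype.linearIndependent_iff]
    intro g hg
    simp only [Fin.sum_univ_three, Matrix.cons_val_zero, Matrix.cons_val_one, Matrix.cons_val] at hg
    obtain ⟨h0, h1, h2⟩ := h _ _ _ hg
    intro i
    fin_cases i <;> assumption
  -- The differences `a - b` and `a - c` are in the radical of the form restricted to the span of
  -- the three vectors. The nonsingular matrix sends them to independent elements of the annihilator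
  -- of this span, which is only one-dimensional.
  have hW := finrank_ann (Submodule.span ℂ (Set.range ![a, b, c]))
  rw [finrank_span_eq_card hli, Fintype.card_fin] at hW
  have hmem : ∀ t, Γ.dual a t = 0 → Γ.dual b t = 0 → Γ.dual c t = 0 →
      Γ.mat⁻¹ *ᵥ t ∈ ann (Submodule.span ℂ (Set.range ![a, b, c])) := by
    intro t h1 h2 h3
    rw [mem_ann]
    intro y hy
    rw [← Quadric.dual_apply]
    have : Submodule.span ℂ (Set.range ![a, b, c]) ≤ LinearMap.ker (Γ.dual t) := by
      rw [Submodule.span_le]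
      rintro _ ⟨i, rfl⟩
      rw [SetLike.mem_coe, LinearMap.mem_ker, Γ.dual_symm]
      fin_cases i <;> assumption
    rw [Γ.dual_symm]
    exact this hy
  have hli2 : LinearIndependent ℂ ![Γ.mat⁻¹ *ᵥ (a - b), Γ.mat⁻¹ *ᵥ (a - c)] := by
    rw [LinearIndependent.pair_iff]
    intro s t hst
    rw [← mulVec_smul, ← mulVec_smul, ← mulVec_add] at hst
    have h0 : s • (a - b) + t • (a - c) = 0 := by
      rw [← Γ.mat_mulVec_inv (s • (a - b) + t • (a - c)), hst, mulVec_zero]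
    have := h (s + t) (-s) (-t) (by rw [← h0]; module)
    exact ⟨neg_eq_zero.1 this.2.1, neg_eq_zero.1 this.2.2⟩
  have h1 := finrank_span_eq_card hli2
  rw [Matrix.range_cons_cons_empty] at h1
  have h2 := Submodule.finrank_mono (Submodule.span_le.2 (by
      rintro _ (rfl | rfl)
      exacts [hmem _ hab hbb hcb, hmem _ hac hbc hcc]) :
    Submodule.span ℂ {Γ.mat⁻¹ *ᵥ (a - b), Γ.mat⁻¹ *ᵥ (a - c)} ≤
      ann (Submodule.span ℂ (Set.range ![a, b, c])))
  rw [h1, hW] at h2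
  simp at h2

theorem pairIndex_opposite : ∀ i j k l : Fin 4, i ≠ j → i ≠ k → i ≠ l → j ≠ k → j ≠ l → k ≠ l →
    pairIndex i j = pairIndex k l := by
  have h : ∀ i j k l : Fin 4, (i ≠ j ∧ i ≠ k ∧ i ≠ l) ∧ (j ≠ k ∧ j ≠ l ∧ k ≠ l) →
      pairIndex i j = pairIndex k l := by decide
  intro i j k l h1 h2 h3 h4 h5 h6
  exact h i j k l ⟨⟨h1, h2, h3⟩, h4, h5, h6⟩

/-! ### Normalized coordinates of a general configuration -/

namespace Config

variable {c : Config} {F : DualPencil}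

/-- If `B` vanished at `a i`, every form `A + ε B` would too; for a small nonzero `ε` it is
nonsingular and gives a second quadric tangent to the plane. -/
theorem IsGeneral.form_ne_zero (hc : c.IsLebesgue F) (hg : c.IsGeneral F) {a : Fin 4 → Coord}
    (ha : c.HasCoords a) {B : Matrix (Fin 4) (Fin 4) ℂ} (hB : B ∈ F.forms)
    (hBA : B ∉ Submodule.span ℂ {(c.quadric 0).mat⁻¹}) (i : Fin 4) :
    toBilin' B (a i) (a i) ≠ 0 := by
  intro h0
  obtain ⟨ε, hε, hdet⟩ := exists_det_add_smul_ne_zero (c.quadric 0).inv_det B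
  have hmem : (c.quadric 0).mat⁻¹ + ε • B ∈ F.forms :=
    add_mem (hc.mem 0) (F.forms.smul_mem _ hB)
  let Γ := Quadric.ofDual _ (F.symm _ hmem) hdet
  have hΓ : Γ.mat⁻¹ = (c.quadric 0).mat⁻¹ + ε • B := Quadric.ofDual_inv _ _ _
  have hs := hg i Γ (by rw [DualPencil.Has, hΓ]; exact hmem) (by
    rw [ha.plane, Γ.isTangentPlane_planeOf (ha.ne_zero i), Quadric.dual, hΓ, map_add, map_smul]
    have := ha.tangent i
    rw [Quadric.dual] at this
    simp [this, h0])
  obtain ⟨r, hr, hr'⟩ := (Quadric.same_iff _ _).1 hs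
  rw [hΓ] at hr'
  apply hBA
  rw [Submodule.mem_span_singleton]
  refine ⟨ε⁻¹ * (r - 1), ?_⟩
  have : ε • B = (r - 1) • (c.quadric 0).mat⁻¹ := by
    rw [sub_smul, one_smul, ← hr']; abel
  rw [mul_smul, ← this, smul_smul, inv_mul_cancel₀ hε, one_smul]

/-- Plane coordinates on which the second form `B` of the pencil is `1` and for which the contact
planes have the coordinates `a i - a j`. -/
structure Normalized (c : Config) (B : Matrix (Fin 4) (Fin 4) ℂ) (a : Fin 4 → Coord) : Prop
    extends c.HasCoords a where
  norm : ∀ i, toBilin' B (a i) (a i) = 1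
  affine : ∃ D : Submodule ℂ Coord, finrank ℂ D = 2 ∧ ∀ i j, i ≠ j → a i - a j ∈ D
  radical : ∀ i j, i ≠ j → ∃ x s : ℂ, x ≠ 0 ∧
    (c.quadric (pairIndex i j)).mat⁻¹ = x • (B + s • (c.quadric 0).mat⁻¹) ∧
    toBilin' B (a i) (a j) + s * (c.quadric 0).dual (a i) (a j) = 1

/-- Once `B` is 1 on all four vectors, the form of edge `ij` has equal diagonal entries there, so
rank one forces its off-diagonal entry to be that entry times a sign `η i j`. Since the contact
vectors `a i - η i j a j` all lie in the two-dimensional `D`, the signs form a coboundary and can be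
absorbed into the vectors. -/
theorem IsGeneral.exists_normalized (hc : c.IsLebesgue F) (hg : c.IsGeneral F)
    {B : Matrix (Fin 4) (Fin 4) ℂ} (hB : B ∈ F.forms)
    (hBA : B ∉ Submodule.span ℂ {(c.quadric 0).mat⁻¹}) : ∃ a, c.Normalized B a := by
  obtain ⟨a₀, ha₀⟩ := hc.exists_hasCoords
  have hroot : ∀ i, ∃ e : ℂ, e ≠ 0 ∧ e * (e * toBilin' B (a₀ i) (a₀ i)) = 1 := by
    intro i
    have hne := hg.form_ne_zero hc ha₀ hB hBA i
    obtain ⟨e, he⟩ := IsAlgClosed.exists_pow_nat_eq (toBilin' B (a₀ i) (a₀ i))⁻¹ (n := 2) (by simp)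
    refine ⟨e, ?_, ?_⟩
    · rintro rfl
      simp at he
      exact hne he.symm
    · rw [← mul_assoc, ← pow_two, he, inv_mul_cancel₀ hne]
  choose e he0 he using hroot
  obtain ⟨a₁, ha₁, hn₁⟩ : ∃ a₁, c.HasCoords a₁ ∧ ∀ i, toBilin' B (a₁ i) (a₁ i) = 1 :=
    ⟨_, ha₀.smul he0, fun i => by simpa using he i⟩
  obtain ⟨D, hD, hcon⟩ := hc.exists_axis ha₁
  have hsign : ∀ i j, i ≠ j → ∃ η : ℂ, η ^ 2 = 1 ∧ a₁ i - η • a₁ j ∈ D ∧ ∃ x s : ℂ, x ≠ 0 ∧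
      (c.quadric (pairIndex i j)).mat⁻¹ = x • (B + s • (c.quadric 0).mat⁻¹) ∧
      toBilin' B (a₁ i) (a₁ j) + s * (c.quadric 0).dual (a₁ i) (a₁ j) = η := by
    intro i j hij
    obtain ⟨p, q, h0, hmem, h1, h2, h3⟩ := hcon i j hij
    obtain ⟨x, y, hxy⟩ := DualPencil.exists_combination (hc.mem 0) hB (c.quadric 0).inv_ne_zero hBA
      (hc.mem (pairIndex i j))
    have hdual : ∀ u v, (c.quadric (pairIndex i j)).dual u v =
        x * toBilin' B u v + y * (c.quadric 0).dual u v := by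
      intro u v
      rw [Quadric.dual, hxy]
      simp [Quadric.dual]
    have hBs := toBilin'_symm (F.symm B hB) (a₁ j) (a₁ i)
    have hAs := (c.quadric 0).dual_symm (a₁ j) (a₁ i)
    simp only [hdual, map_add, map_smul, smul_eq_mul, hn₁, ha₁.tangent, hBs, hAs] at h1 h2 h3
    -- The Gram matrix of the form on the pair has rows `(x, z)` and `(z, x)`; it is nonzero and has
    -- the kernel vector `(p, q)`, whence `x ≠ 0` and `z = ± x`.
    set z := x * toBilin' B (a₁ i) (a₁ j) + y * (c.quadric 0).dual (a₁ i) (a₁ j) with hz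
    have e1 : p * x + q * z = 0 := by linear_combination h1
    have e2 : p * z + q * x = 0 := by linear_combination h2
    have h3' : ¬ (x = 0 ∧ z = 0) := fun h => h3 (by simp [h.1, h.2])
    have hpq : ¬ (p = 0 ∧ q = 0) := fun h => h0 (by simp [h.1, h.2])
    have hx : x ≠ 0 := by
      intro hx
      rw [hx] at e1 e2
      have hz0 : z ≠ 0 := fun h => h3' ⟨hx, h⟩
      apply hpq
      constructor
      · simpa [hz0] using e2
      · simpa [hz0] using e1
    have hp : p ≠ 0 := by
      intro hp
      rw [hp] at e2
      exact hpq ⟨hp, by simpa [hx] using e2⟩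
    have hzx : (z / x) ^ 2 = 1 := by
      have : p * (x ^ 2 - z ^ 2) = 0 := by linear_combination x * e1 - z * e2
      have : x ^ 2 = z ^ 2 := by
        rcases mul_eq_zero.1 this with h | h
        · exact absurd h hp
        · linear_combination h
      rw [div_pow, ← this, div_self (pow_ne_zero 2 hx)]
    refine ⟨z / x, hzx, ?_, x, y / x, hx, ?_, ?_⟩
    · have : a₁ i - (z / x) • a₁ j = p⁻¹ • (p • a₁ i + q • a₁ j) := by
        rw [smul_add, smul_smul, smul_smul, inv_mul_cancel₀ hp, one_smul, sub_eq_add_neg, ← neg_smul]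
        congr 2
        field_simp
        linear_combination - e2
      rw [this]
      exact D.smul_mem _ hmem
    · rw [hxy, smul_add, smul_smul, mul_div_cancel₀ _ hx]
    · rw [hz]; field_simp
  choose η hη1 hηD hηr using hsign
  -- The signs are read off from the edges at vertex 0, with the default 1 at that vertex itself.
  let ε : Fin 4 → ℂ := fun j => if h : 0 ≠ j then η 0 j h else 1
  have hε2 : ∀ j, ε j ^ 2 = 1 := by
    intro j
    by_cases h : 0 ≠ j
    · simp [ε, h, hη1]
    · simp [ε, h]
  have hε0 : ∀ j, ε j ≠ 0 := by
    intro j h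
    have := hε2 j
    rw [h] at this
    simp at this
  have hε00 : ε 0 = 1 := by simp [ε]
  have hD0 : ∀ j, 0 ≠ j → a₁ 0 - ε j • a₁ j ∈ D := by
    intro j h
    simp only [ε, dif_pos h]
    exact hηD 0 j h
  have ha₂ := ha₁.smul hε0
  -- Two contact vectors at vertex 0 form a basis of `D`. Expanding the contact vector of `ij` in it
  -- and comparing coefficients of three independent `a₁` determines `η i j`. For an edge ending at
  -- 0 an auxiliary third vertex supplies the second basis vector.
  have hkey : ∀ i j (hij : i ≠ j), η i j hij = ε i * ε j := by
    intro i j hij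
    have hmem := hηD i j hij
    have hind : ∀ k l, 0 ≠ k → 0 ≠ l → k ≠ l → ∀ p q : ℂ,
        p • (a₁ 0 - ε k • a₁ k) + q • (a₁ 0 - ε l • a₁ l) = 0 → p = 0 ∧ q = 0 := by
      intro k l hk hl hkl p q hpq
      have := ha₁.indep 0 k l hk hl hkl (p + q) (-(p * ε k)) (-(q * ε l))
        (by rw [← hpq]; module)
      simpa [hε0] using this.2
    by_cases h0i : 0 = i
    · subst h0i
      simp [ε, hij]
    by_cases h0j : 0 = j
    · subst h0j
      obtain ⟨k, hik, h0k⟩ := exists_third i 0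
      obtain ⟨p, q, hpq⟩ := exists_combination_of_mem hD (hD0 i h0i) (hD0 k h0k) hmem
        (hind i k h0i h0k hik)
      obtain ⟨h1, h2, h3⟩ := ha₁.indep 0 i k h0i h0k hik (p + q + η i 0 hij) (-(p * ε i) - 1)
        (-(q * ε k)) (by rw [← sub_eq_zero.2 hpq]; module)
      have hq : q = 0 := by simpa [hε0] using h3
      rw [hε00]
      linear_combination h1 - hq + ε i * h2 + p * hε2 i
    · obtain ⟨p, q, hpq⟩ := exists_combination_of_mem hD (hD0 i h0i) (hD0 j h0j) hmem
        (hind i j h0i h0j hij)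
      obtain ⟨h1, h2, h3⟩ := ha₁.indep 0 i j h0i h0j hij (p + q) (-(p * ε i) - 1)
        (-(q * ε j) + η i j hij) (by rw [← sub_eq_zero.2 hpq]; module)
      linear_combination h3 + ε i * ε j * h2 + p * ε j * hε2 i + ε j * h1
  refine ⟨_, ha₂, fun i => ?_, ⟨D, hD, fun i j hij => ?_⟩, fun i j hij => ?_⟩
  · have := hε2 i
    simp only [map_smul, LinearMap.smul_apply, smul_eq_mul, hn₁]
    linear_combination this
  · have := D.smul_mem (ε i) (hηD i j hij)
    rw [hkey i j hij, smul_sub, smul_smul] at this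
    convert this using 3
    linear_combination - ε j * hε2 i
  · obtain ⟨x, s, hx, h1, h2⟩ := hηr i j hij
    refine ⟨x, s, hx, h1, ?_⟩
    rw [hkey i j hij] at h2
    simp only [map_smul, LinearMap.smul_apply, smul_eq_mul]
    linear_combination ε i * ε j * h2 + ε i ^ 2 * hε2 j + hε2 i

end Config

theorem Fin.exists_other_pair (i j : Fin 4) (hij : i ≠ j) :
    ∃ k l : Fin 4, i ≠ k ∧ i ≠ l ∧ j ≠ k ∧ j ≠ l ∧ k ≠ l := by
  revert i j; decide

theorem Fin.exists_fourth (i j k : Fin 4) : ∃ l : Fin 4, i ≠ l ∧ j ≠ l ∧ k ≠ l := by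
  revert i j k; decide

theorem Fin.eq_of_four_distinct {i j k l : Fin 4} (hij : i ≠ j) (hik : i ≠ k) (hil : i ≠ l)
    (hjk : j ≠ k) (hjl : j ≠ l) (hkl : k ≠ l) (m : Fin 4) : m = i ∨ m = j ∨ m = k ∨ m = l := by
  omega

namespace Config

variable {c c' : Config} {F : DualPencil} {B : Matrix (Fin 4) (Fin 4) ℂ} {a a' : Fin 4 → Coord}

namespace Normalized

theorem dual_apply (h : c.Normalized B a) {i j : Fin 4} (hij : i ≠ j) : ∃ x s : ℂ, x ≠ 0 ∧
    (∀ u v, (c.quadric (pairIndex i j)).dual u v =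
      x * (toBilin' B u v + s * (c.quadric 0).dual u v)) ∧
    toBilin' B (a i) (a j) + s * (c.quadric 0).dual (a i) (a j) = 1 := by
  obtain ⟨x, s, hx, h1, h2⟩ := h.radical i j hij
  refine ⟨x, s, hx, fun u v => ?_, h2⟩
  rw [Quadric.dual, h1]
  simp [Quadric.dual, mul_add]

theorem neg (h : c.Normalized B a) : c.Normalized B (fun i => - a i) where
  toHasCoords := by simpa using h.toHasCoords.smul (e := fun _ => -1) (by simp)
  norm i := by simp [h.norm i]
  affine := by
    obtain ⟨D, hD, h1⟩ := h.affine
    refine ⟨D, hD, fun i j hij => ?_⟩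
    have := D.neg_mem (h1 i j hij)
    rwa [neg_sub'] at this
  radical i j hij := by simpa using h.radical i j hij

/-- Each of the four coordinate vectors is an affine combination of the other three. -/
theorem exists_affine (h : c.Normalized B a) {i j k l : Fin 4} (hij : i ≠ j) (hik : i ≠ k)
    (hil : i ≠ l) (hjk : j ≠ k) (hjl : j ≠ l) (hkl : k ≠ l) :
    ∃ p q r : ℂ, p ≠ 0 ∧ q ≠ 0 ∧ r ≠ 0 ∧ p + q + r = 1 ∧ a l = p • a i + q • a j + r • a k := by
  obtain ⟨D, hD, hmem⟩ := h.affine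
  obtain ⟨x, y, hxy⟩ := exists_combination_of_mem hD (hmem j i hij.symm) (hmem k i hik.symm)
    (hmem l i hil.symm) (by
      intro p q hpq
      have := h.indep i j k hij hik hjk (-p - q) p q (by rw [← hpq]; module)
      exact this.2)
  have hl : a l = (1 - x - y) • a i + x • a j + y • a k := by
    rw [← sub_eq_zero, ← neg_eq_zero, ← sub_eq_zero.2 hxy]; module
  refine ⟨1 - x - y, x, y, ?_, ?_, ?_, by ring, hl⟩
  · intro h0
    rw [h0] at hl
    have := h.indep j k l hjk hjl hkl x y (-1) (by rw [hl]; module)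
    simp at this
  · intro h0
    rw [h0] at hl
    have := h.indep i k l hik hil hkl (1 - 0 - y) y (-1) (by rw [hl]; module)
    simp at this
  · intro h0
    rw [h0] at hl
    have := h.indep i j l hij hil hjl (1 - x - 0) x (-1) (by rw [hl]; module)
    simp at this

/-- No form `B + s A₀` of a quadric of the configuration takes the value `1` on three different
pairs. -/
theorem not_constant (h : c.Normalized B a) (hB : B.IsSymm) {i j k m n : Fin 4} (hij : i ≠ j)
    (hik : i ≠ k) (hjk : j ≠ k) {x s : ℂ}
    (hd : ∀ u v, (c.quadric (pairIndex m n)).dual u v =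
      x * (toBilin' B u v + s * (c.quadric 0).dual u v))
    (h1 : toBilin' B (a i) (a j) + s * (c.quadric 0).dual (a i) (a j) = 1)
    (h2 : toBilin' B (a i) (a k) + s * (c.quadric 0).dual (a i) (a k) = 1)
    (h3 : toBilin' B (a j) (a k) + s * (c.quadric 0).dual (a j) (a k) = 1) : False := by
  have hji := toBilin'_symm hB (a j) (a i)
  have hki := toBilin'_symm hB (a k) (a i)
  have hkj := toBilin'_symm hB (a k) (a j)
  have hji' := (c.quadric 0).dual_symm (a j) (a i)
  have hki' := (c.quadric 0).dual_symm (a k) (a i)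
  have hkj' := (c.quadric 0).dual_symm (a k) (a j)
  apply (c.quadric (pairIndex m n)).gram_not_constant (h.indep i j k hij hik hjk) <;>
    simp only [hd, map_sub, h.norm, h.tangent, hji, hki, hkj, hji', hki', hkj']
  · linear_combination -x * h1
  · linear_combination -x * h2
  · linear_combination x * h1
  · linear_combination x * (h1 - h3)
  · linear_combination x * (h2 - h3)
  · linear_combination x * h2

/-- If `A` vanished on `(a i, a j)`, every `B + s A` would be 1 there. The quadric shared by the
edges `ik` and `jl` is moreover 1 on both of these; writing `a l` affinely through the other three,
it is also 1 on `jk`, which `not_constant` forbids. -/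
theorem dual_ne_zero (h : c.Normalized B a) (hB : B.IsSymm) {i j : Fin 4} (hij : i ≠ j) :
    (c.quadric 0).dual (a i) (a j) ≠ 0 := by
  intro h0
  obtain ⟨k, l, hik, hil, hjk, hjl, hkl⟩ := Fin.exists_other_pair i j hij
  obtain ⟨p, q, r, hp, hq, hr, hsum, hl⟩ := h.exists_affine hij hik hil hjk hjl hkl
  obtain ⟨x₁, s₁, -, -, e₁⟩ := h.dual_apply hij
  obtain ⟨x, s, hx, hd, e⟩ := h.dual_apply hik
  obtain ⟨x', s', hx', hd', e'⟩ := h.dual_apply hjl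
  rw [← pairIndex_opposite i k j l hik hij hil hjk.symm hkl hjl] at hd'
  -- Evaluation at `(a i, a i)`, where `A` is 0 and `B` is 1, shows that both expressions for the
  -- shared quadric have the same factor `x`.
  have e2 : toBilin' B (a j) (a l) + s * (c.quadric 0).dual (a j) (a l) = 1 := by
    have e3 := (hd (a i) (a i)).symm.trans (hd' (a i) (a i))
    have e4 := (hd (a j) (a l)).symm.trans (hd' (a j) (a l))
    rw [h.norm, h.tangent] at e3
    have : x = x' := by linear_combination e3
    subst this
    have e5 := mul_left_cancel₀ hx e4
    rw [e5, e']
  rw [h0] at e₁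
  have hji := toBilin'_symm hB (a j) (a i)
  have hji' := (c.quadric 0).dual_symm (a j) (a i)
  refine h.not_constant hB hij hik hjk hd (by rw [h0]; linear_combination e₁) e ?_
  rw [hl] at e2
  simp only [map_add, map_smul, smul_eq_mul, h.norm, h.tangent, hji, hji', h0] at e2
  apply mul_left_cancel₀ hr
  linear_combination e2 - p * e₁ - hsum

theorem contactPlane_eq (h : c.Normalized B a) {i j : Fin 4} (hij : i ≠ j)
    {τ : Submodule ℂ Coord} (hτ : c.IsContactPlane i j τ) : τ = planeOf (a i - a j) := by
  obtain ⟨p, q, h0, rfl, h1, -, -⟩ := (h.isContactPlane_iff hij τ).1 hτ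
  obtain ⟨x, s, hx, hd, e⟩ := h.dual_apply hij
  simp only [map_add, map_smul, smul_eq_mul, hd, h.norm, h.tangent] at h1
  have hq : q = -p := by
    apply mul_left_cancel₀ hx
    linear_combination h1 - q * x * e
  subst hq
  have hp : p ≠ 0 := by
    rintro rfl
    simp at h0
  rw [← planeOf_smul hp (a i - a j)]
  congr 1
  module

theorem sub_ne_zero (h : c.Normalized B a) {i j : Fin 4} (hij : i ≠ j) : a i - a j ≠ 0 := by
  intro h0
  have := h.indep_pair hij 1 (-1) (by rw [← h0]; module)
  simp at this

/-- The quadrics of a normalized configuration are determined by `Γ₀` and the coordinates. -/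
theorem same_of_coords (h : c.Normalized B a) (h' : c'.Normalized B a') (hB : B.IsSymm)
    (h0 : (c.quadric 0).Same (c'.quadric 0)) {σ : Fin 4 → Fin 4} (hσ : Function.Injective σ)
    (ha : ∀ i, a' i = a (σ i)) (i j : Fin 4) :
    (c.quadric (pairIndex (σ i) (σ j))).Same (c'.quadric (pairIndex i j)) := by
  have hdiag : ∀ m : Fin 4, pairIndex m m = 0 := by decide
  by_cases hij : i = j
  · subst hij
    rwa [hdiag, hdiag]
  have hσij : σ i ≠ σ j := fun e => hij (hσ e)
  obtain ⟨x, s, hx, h1, h2⟩ := h.radical _ _ hσij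
  obtain ⟨x', s', hx', h1', h2'⟩ := h'.radical i j hij
  obtain ⟨r, hr, h3⟩ := (Quadric.same_iff _ _).1 h0
  have hne := h.dual_ne_zero hB hσij
  have hdual : ∀ u v, (c'.quadric 0).dual u v = r * (c.quadric 0).dual u v := by
    intro u v
    rw [Quadric.dual, h3]
    simp [Quadric.dual]
  rw [ha i, ha j, hdual] at h2'
  -- The value 1 on the pair pins down the parameter, because `A` does not vanish there.
  have hs : s = s' * r := by
    apply mul_right_cancel₀ hne
    linear_combination h2 - h2'
  rw [Quadric.same_iff]
  refine ⟨x' / x, div_ne_zero hx' hx, ?_⟩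
  rw [h1, h1', h3, smul_smul s', ← hs, smul_smul, div_mul_cancel₀ _ hx]

end Normalized

/-! ### Uniqueness from two lines and their contact planes -/

theorem _root_.Quadric.Same.dual_eq {Γ Γ' : Quadric} (h : Γ.Same Γ') :
    ∃ r : ℂ, r ≠ 0 ∧ ∀ u v, Γ'.dual u v = r * Γ.dual u v := by
  obtain ⟨r, hr, h3⟩ := (Quadric.same_iff _ _).1 h
  refine ⟨r, hr, fun u v => ?_⟩
  rw [Quadric.dual, h3]
  simp [Quadric.dual]

theorem _root_.Quadric.Same.span_eq {Γ Γ' : Quadric} (h : Γ.Same Γ') :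
    Submodule.span ℂ {Γ'.mat⁻¹} = Submodule.span ℂ {Γ.mat⁻¹} := by
  obtain ⟨r, hr, h3⟩ := (Quadric.same_iff _ _).1 h
  rw [h3]
  exact Submodule.span_singleton_smul_eq (Ne.isUnit hr) _

theorem HasCoords.mem_span_of_line_eq (h : c.HasCoords a) (h' : c'.HasCoords a') {i j : Fin 4}
    (hl : c.line i j = c'.line i j) : ∃ p q : ℂ, p • a i + q • a j = a' i := by
  rw [h.line_eq, h'.line_eq, planeOf_inf_planeOf, planeOf_inf_planeOf] at hl
  have : a' i ∈ Submodule.span ℂ {a i, a j} := by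
    rw [ann_injective hl]
    exact Submodule.subset_span (by simp)
  exact Submodule.mem_span_pair.1 this

/-- On a line of the configuration only the two given planes are tangent to `Γ₀`. -/
theorem Normalized.eq_or_of_line_eq (h : c.Normalized B a) (h' : c'.Normalized B a')
    (hB : B.IsSymm) (h0 : (c.quadric 0).Same (c'.quadric 0)) {i j : Fin 4} (hij : i ≠ j)
    (hl : c.line i j = c'.line i j) :
    ∃ e : ℂ, e ^ 2 = 1 ∧ (a' i = e • a i ∨ a' i = e • a j) := by
  obtain ⟨p, q, hpq⟩ := h.mem_span_of_line_eq h'.toHasCoords hl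
  obtain ⟨r, hr, hd⟩ := h0.dual_eq
  have ht := h'.tangent i
  have hn := h'.norm i
  rw [hd, ← hpq] at ht
  rw [← hpq] at hn
  have hs := (c.quadric 0).dual_symm (a j) (a i)
  have hs' := toBilin'_symm hB (a j) (a i)
  simp only [map_add, map_smul, LinearMap.add_apply, LinearMap.smul_apply, smul_eq_mul,
    h.tangent, h.norm, hs, hs'] at ht hn
  have hne := h.dual_ne_zero hB hij
  -- On the span of the two isotropic vectors `A` is `2 p q A (a i) (a j)`, so only their multiples
  -- are isotropic.
  have : (2 * r * (c.quadric 0).dual (a i) (a j)) * (p * q) = 0 := by linear_combination ht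
  rcases mul_eq_zero.1 this with h1 | h1
  · simp [hr, hne] at h1
  rcases mul_eq_zero.1 h1 with rfl | rfl
  · exact ⟨q, by linear_combination hn, Or.inr (by rw [← hpq]; simp)⟩
  · exact ⟨p, by linear_combination hn, Or.inl (by rw [← hpq]; simp)⟩

theorem line_symm (c : Config) (i j : Fin 4) : c.line i j = c.line j i := inf_comm _ _

theorem eq_one_of_planeOf_eq {u v : Coord}
    (h : ∀ p q : ℂ, p • u + q • v = 0 → p = 0 ∧ q = 0) {e : ℂ}
    (hpl : planeOf (u - v) = planeOf (u - e • v)) : e = 1 := by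
  have hne : u - e • v ≠ 0 := fun h0 => by
    have := h 1 (-e) (by rw [← h0]; module)
    simp at this
  obtain ⟨r, hr, h1⟩ := exists_smul_of_planeOf_eq hne hpl
  have := h (1 - r) (r - e) (by rw [← sub_eq_zero.2 h1]; module)
  linear_combination -this.1 - this.2

/-- A plane, a line in it and the contact plane of the line determine the second plane through
the line. -/
theorem Normalized.eq_of_fst_eq (h : c.Normalized B a) (h' : c'.Normalized B a')
    (hB : B.IsSymm) (h0 : (c.quadric 0).Same (c'.quadric 0)) {i j : Fin 4} (hij : i ≠ j)
    (hl : c.line i j = c'.line i j) (hi : a' i = a i) {μ : Submodule ℂ Coord}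
    (hμ : c.IsContactPlane i j μ) (hμ' : c'.IsContactPlane i j μ) : a' j = a j := by
  have hpl := (h.contactPlane_eq hij hμ).symm.trans (h'.contactPlane_eq hij hμ')
  rw [line_symm, line_symm c'] at hl
  obtain ⟨e, he, h1 | h1⟩ := h.eq_or_of_line_eq h' hB h0 hij.symm hl
  · rw [hi, h1] at hpl
    have := eq_one_of_planeOf_eq (h.indep_pair hij) hpl
    rw [h1, this, one_smul]
  · exfalso
    have := h'.indep_pair hij e (-1) (by rw [hi, h1]; module)
    simp at this

/-- Uniqueness of the fourth base point. -/
theorem coefficients_eq {p q r p' q' r' α β γ b₁ b₂ b₃ : ℂ} (hp : p ≠ 0) (hq : q ≠ 0)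
    (hr : r ≠ 0) (hr' : r' ≠ 0) (hα : α ≠ 0)
    (hs : p + q + r = 1) (hs' : p' + q' + r' = 1)
    (h1 : α * (p * q) + β * (p * r) + γ * (q * r) = 0)
    (h2 : b₁ * (p * q) + b₂ * (p * r) + b₃ * (q * r) = 0)
    (h1' : α * (p' * q') + β * (p' * r') + γ * (q' * r') = 0)
    (h2' : b₁ * (p' * q') + b₂ * (p' * r') + b₃ * (q' * r') = 0)
    (hp' : p' ≠ 0)
    (hne : ∀ s : ℂ, b₁ = s * α → b₂ = s * β → b₃ = s * γ → False) :
    p' = p ∧ q' = q ∧ r' = r := by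
  -- Division by `p q r` turns both conics through the three base points into linear equations in
  -- `1/p, 1/q, 1/r`. By `hne` they are independent, so they fix these up to a common factor, and
  -- the sum condition fixes the factor. The computation eliminates the first coefficient with the
  -- ratio `s`.
  have hb₁ : b₁ = b₁ / α * α := by field_simp
  set s := b₁ / α
  have e : (b₂ - s * β) * p + (b₃ - s * γ) * q = 0 := by
    apply mul_left_cancel₀ hr
    linear_combination h2 - s * h1 - p * q * hb₁
  have e' : (b₂ - s * β) * p' + (b₃ - s * γ) * q' = 0 := by
    apply mul_left_cancel₀ hr'
    linear_combination h2' - s * h1' - p' * q' * hb₁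
  have hγ : b₃ - s * γ ≠ 0 := by
    intro h0
    rw [h0, zero_mul, add_zero] at e
    have : b₂ - s * β = 0 := (mul_eq_zero.1 e).resolve_right hp
    exact hne s hb₁ (by linear_combination this) (by linear_combination h0)
  have epq : p * q' = p' * q := by
    apply mul_left_cancel₀ hγ
    linear_combination p * e' - p' * e
  have e3 : r' * (β * p + γ * q) = - (α * (p * q')) := by
    apply mul_left_cancel₀ hp'
    linear_combination p * h1' + γ * r' * (-epq)
  have e4 : r * (β * p + γ * q) = - (α * (p * q)) := by linear_combination h1
  have e5 : α * p * (q * r' - r * q') = 0 := by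
    linear_combination r' * e4 - r * e3
  have e6 : q * r' = r * q' := by
    have := (mul_eq_zero.1 e5).resolve_left (mul_ne_zero hα hp)
    linear_combination this
  have hqq : q' = q := by linear_combination -q' * hs + q * hs' + epq - e6
  subst hqq
  have hpp : p' = p := by
    apply mul_right_cancel₀ hq
    linear_combination -epq
  exact ⟨hpp, rfl, by linear_combination hs' - hs - hpp⟩

/-- A general configuration is determined by two adjacent lines and their contact planes. -/
theorem eq_of_adjacent_lines (hc : c.IsLebesgue F) (hg : c.IsGeneral F) (hc' : c'.IsLebesgue F)
    (hg' : c'.IsGeneral F) {i j k : Fin 4} (hij : i ≠ j) (hik : i ≠ k) (hjk : j ≠ k)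
    (hl : c.line i j = c'.line i j) (hl' : c.line i k = c'.line i k) {μ τ : Submodule ℂ Coord}
    (hμ : c.IsContactPlane i j μ) (hμ' : c'.IsContactPlane i j μ)
    (hτ : c.IsContactPlane i k τ) (hτ' : c'.IsContactPlane i k τ) :
    (∀ m, c'.plane m = c.plane m) ∧ ∀ m, (c.quadric m).Same (c'.quadric m) := by
  -- The plane `i` is the span of the two given lines, hence common to both configurations; by
  -- generality only one quadric of the pencil is tangent to it.
  have h0 : (c.quadric 0).Same (c'.quadric 0) := by
    obtain ⟨b, hb⟩ := hc.exists_hasCoords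
    obtain ⟨b', hb'⟩ := hc'.exists_hasCoords
    obtain ⟨p, q, h1⟩ := hb.mem_span_of_line_eq hb' hl
    obtain ⟨r, s, h2⟩ := hb.mem_span_of_line_eq hb' hl'
    obtain ⟨-, hq, -⟩ := hb.indep i j k hij hik hjk (p - r) q (-s) (by
      rw [← sub_eq_zero.2 (h1.trans h2.symm)]; module)
    rw [hq, zero_smul, add_zero] at h1
    have hp : p ≠ 0 := by
      rintro rfl
      exact hb'.ne_zero i (by rw [← h1, zero_smul])
    apply hg i _ (hc'.mem 0)
    have := hc'.tangent i
    rwa [hb'.plane, ← h1, planeOf_smul hp, ← hb.plane] at this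
  obtain ⟨B, hBF, hBA⟩ := F.exists_not_mem_span (c.quadric 0).mat⁻¹
  have hB := F.symm B hBF
  obtain ⟨a, h⟩ := hg.exists_normalized hc hBF hBA
  -- Normalized coordinates are free up to a common sign, which is used to match `a' i` with `a i`.
  obtain ⟨a', h', hi⟩ : ∃ a', c'.Normalized B a' ∧ a' i = a i := by
    obtain ⟨a', h'⟩ := hg'.exists_normalized hc' hBF (by rwa [h0.span_eq])
    obtain ⟨e, he, h1 | h1⟩ := h.eq_or_of_line_eq h' hB h0 hij hl
    · rcases mul_self_eq_one_iff.1 ((sq e).symm.trans he) with rfl | rfl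
      · exact ⟨a', h', by rw [h1, one_smul]⟩
      · exact ⟨_, h'.neg, by simp [h1]⟩
    · exfalso
      obtain ⟨e', he', h2 | h2⟩ := h.eq_or_of_line_eq h' hB h0 hik hl'
      · have := h.indep_pair hij e' (-e) (by rw [← sub_eq_zero.2 (h2.symm.trans h1)]; module)
        rw [this.1] at he'; simp at he'
      · have := h.indep_pair hjk e (-e') (by rw [← sub_eq_zero.2 (h1.symm.trans h2)]; module)
        rw [this.1] at he; simp at he
  have hj := h.eq_of_fst_eq h' hB h0 hij hl hi hμ hμ'
  have hk := h.eq_of_fst_eq h' hB h0 hik hl' hi hτ hτ'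
  obtain ⟨l, hil, hjl, hkl⟩ := Fin.exists_fourth i j k
  -- Barycentric coordinates of `a l` and `a' l` on the same three vectors satisfy the same two
  -- equations, from `A = 0` and `B = 1`. Were these proportional, one form `B + s A` would be 1 on
  -- all three pairs, against `not_constant`.
  have hal : a' l = a l := by
    obtain ⟨p, q, r, hp, hq, hr, hs, e⟩ := h.exists_affine hij hik hil hjk hjl hkl
    obtain ⟨p', q', r', hp', hq', hr', hs', e'⟩ := h'.exists_affine hij hik hil hjk hjl hkl
    rw [hi, hj, hk] at e'
    obtain ⟨ρ, hρ, hd⟩ := h0.dual_eq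
    have t := h.tangent l
    have t' := h'.tangent l
    have n := h.norm l
    have n' := h'.norm l
    rw [e] at t n
    rw [hd, e'] at t'
    rw [e'] at n'
    have hji := toBilin'_symm hB (a j) (a i)
    have hki := toBilin'_symm hB (a k) (a i)
    have hkj := toBilin'_symm hB (a k) (a j)
    have hji' := (c.quadric 0).dual_symm (a j) (a i)
    have hki' := (c.quadric 0).dual_symm (a k) (a i)
    have hkj' := (c.quadric 0).dual_symm (a k) (a j)
    simp only [map_add, map_smul, LinearMap.add_apply, LinearMap.smul_apply, smul_eq_mul,
      h.tangent, h.norm, hji, hki, hkj, hji', hki', hkj'] at t n t' n'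
    have t'' := (mul_eq_zero.1 t').resolve_left hρ
    obtain ⟨x, s, hx, hdu, es⟩ := h.dual_apply hij
    have hne := h.dual_ne_zero hB hij
    obtain ⟨rfl, rfl, rfl⟩ := coefficients_eq (α := (c.quadric 0).dual (a i) (a j))
      (β := (c.quadric 0).dual (a i) (a k)) (γ := (c.quadric 0).dual (a j) (a k))
      (b₁ := 1 - toBilin' B (a i) (a j)) (b₂ := 1 - toBilin' B (a i) (a k))
      (b₃ := 1 - toBilin' B (a j) (a k)) hp hq hr hr' hne hs hs'
      (by linear_combination (1 / 2 : ℂ) * t)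
      (by linear_combination (-1 / 2 : ℂ) * n + (1 / 2 : ℂ) * (p + q + r + 1) * hs)
      (by linear_combination (1 / 2 : ℂ) * t'')
      (by linear_combination (-1 / 2 : ℂ) * n' + (1 / 2 : ℂ) * (p' + q' + r' + 1) * hs')
      hp' (by
        intro s' h1 h2 h3
        have : s' = s := by
          apply mul_right_cancel₀ hne
          linear_combination -es - h1
        subst this
        exact h.not_constant hB hij hik hjk hdu es (by linear_combination -h2)
          (by linear_combination -h3))
    rw [e, e']
  have hall : ∀ m, a' m = a m := by
    intro m
    rcases Fin.eq_of_four_distinct hij hik hil hjk hjl hkl m with rfl | rfl | rfl | rfl <;>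
      assumption
  refine ⟨fun m => by rw [h.plane, h'.plane, hall], fun m => ?_⟩
  have := h.same_of_coords h' hB h0 (σ := id) Function.injective_id hall 0 m
  have h0m : ∀ m : Fin 4, pairIndex 0 m = m := by decide
  simpa [h0m] using this

/-- Matching the two planes through a common line of two normalized configurations. -/
theorem Normalized.exists_pair_perm (h : c.Normalized B a) (h' : c'.Normalized B a')
    (hB : B.IsSymm) (h0 : (c.quadric 0).Same (c'.quadric 0)) {i j : Fin 4} (hij : i ≠ j)
    (hl : c.line i j = c'.line i j) {μ : Submodule ℂ Coord} (hμ : c.IsContactPlane i j μ)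
    (hμ' : c'.IsContactPlane i j μ) : ∃ σ : Equiv.Perm (Fin 4), (σ = 1 ∨ σ = Equiv.swap i j) ∧
      ∃ e : ℂ, e ^ 2 = 1 ∧ a' i = e • a (σ i) ∧ a' j = e • a (σ j) := by
  have hpl := (h.contactPlane_eq hij hμ).symm.trans (h'.contactPlane_eq hij hμ')
  have hl2 := hl
  rw [line_symm, line_symm c'] at hl2
  have hneg : ∀ u v : Coord, planeOf (u - v) = planeOf (v - u) := fun u v => by
    rw [← planeOf_smul (neg_ne_zero.2 one_ne_zero) (u - v)]
    congr 1
    module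
  have key : ∀ (u v : Coord) (e e' : ℂ), (∀ p q : ℂ, p • u + q • v = 0 → p = 0 ∧ q = 0) →
      e ^ 2 = 1 → planeOf (u - v) = planeOf (e • u - e' • v) → e' = e := by
    intro u v e e' huv he hpl
    have he0 : e ≠ 0 := by
      rintro rfl
      simp at he
    have : e • u - e' • v = e • (u - (e' * e) • v) := by
      rw [smul_sub, smul_smul]
      congr 2
      linear_combination -e' * he
    rw [this, planeOf_smul he0] at hpl
    have h1 := eq_one_of_planeOf_eq huv hpl
    linear_combination e * h1 - e' * he
  obtain ⟨e, he, h1 | h1⟩ := h.eq_or_of_line_eq h' hB h0 hij hl <;>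
    obtain ⟨e', he', h2 | h2⟩ := h.eq_or_of_line_eq h' hB h0 hij.symm hl2
  · rw [h1, h2] at hpl
    have := key _ _ e e' (h.indep_pair hij) he hpl
    exact ⟨1, Or.inl rfl, e, he, by simpa using h1, by simpa [this] using h2⟩
  · exfalso
    have := h'.indep_pair hij e' (-e) (by rw [h1, h2]; module)
    rw [this.1] at he'
    simp at he'
  · exfalso
    have := h'.indep_pair hij e' (-e) (by rw [h1, h2]; module)
    rw [this.1] at he'
    simp at he'
  · rw [h1, h2, hneg] at hpl
    have := key _ _ e e' (h.indep_pair hij.symm) he hpl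
    exact ⟨Equiv.swap i j, Or.inr rfl, e, he, by simpa using h1, by simpa [this] using h2⟩

/-- A general configuration with given `Γ₀` is determined, up to interchanging planes, by two
opposite lines and their distinct contact planes. -/
theorem exists_perm_of_opposite_lines (hc : c.IsLebesgue F) (hg : c.IsGeneral F)
    (hc' : c'.IsLebesgue F) (hg' : c'.IsGeneral F) (h0 : (c.quadric 0).Same (c'.quadric 0))
    {i j k l : Fin 4} (hij : i ≠ j) (hik : i ≠ k) (hil : i ≠ l) (hjk : j ≠ k) (hjl : j ≠ l)
    (hkl : k ≠ l) (hl : c.line i j = c'.line i j) (hl' : c.line k l = c'.line k l)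
    {μ ν : Submodule ℂ Coord} (hμν : μ ≠ ν)
    (hμ : c.IsContactPlane i j μ) (hμ' : c'.IsContactPlane i j μ)
    (hν : c.IsContactPlane k l ν) (hν' : c'.IsContactPlane k l ν) :
    ∃ σ : Equiv.Perm (Fin 4), ((σ i = i ∧ σ j = j) ∨ (σ i = j ∧ σ j = i)) ∧
      (∀ m, c'.plane m = c.plane (σ m)) ∧
      ∀ m n, (c.quadric (pairIndex (σ m) (σ n))).Same (c'.quadric (pairIndex m n)) := by
  obtain ⟨B, hBF, hBA⟩ := F.exists_not_mem_span (c.quadric 0).mat⁻¹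
  have hB := F.symm B hBF
  obtain ⟨a, h⟩ := hg.exists_normalized hc hBF hBA
  obtain ⟨a₁, h₁⟩ := hg'.exists_normalized hc' hBF (by rwa [h0.span_eq])
  obtain ⟨σ, hσ, e, he, hei, hej⟩ := h.exists_pair_perm h₁ hB h0 hij hl hμ hμ'
  obtain ⟨a', h', hi, hj⟩ : ∃ a', c'.Normalized B a' ∧ a' i = a (σ i) ∧ a' j = a (σ j) := by
    rcases mul_self_eq_one_iff.1 ((sq e).symm.trans he) with rfl | rfl
    · exact ⟨a₁, h₁, by rw [hei, one_smul], by rw [hej, one_smul]⟩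
    · exact ⟨_, h₁.neg, by simp [hei], by simp [hej]⟩
  obtain ⟨σ', hσ', e', he', hek, hel⟩ := h.exists_pair_perm h' hB h0 hkl hl' hν hν'
  have hik' : (σ * σ') i = σ i ∧ (σ * σ') j = σ j ∧ (σ * σ') k = σ' k ∧ (σ * σ') l = σ' l := by
    rcases hσ with rfl | rfl <;> rcases hσ' with rfl | rfl <;>
      simp [Equiv.swap_apply_of_ne_of_ne, *, Ne.symm]
  obtain ⟨hpi, hpj, hpk, hpl⟩ := hik'
  rw [← hpi] at hi
  rw [← hpj] at hj
  rw [← hpk] at hek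
  rw [← hpl] at hel
  have hij' : ((σ * σ') i = i ∧ (σ * σ') j = j) ∨ ((σ * σ') i = j ∧ (σ * σ') j = i) := by
    rw [hpi, hpj]
    rcases hσ with rfl | rfl <;> simp
  generalize σ * σ' = ρ at *
  have hρ := ρ.injective
  -- With opposite signs, the distinct contact vectors of the two given lines would span `D'` and
  -- also lie in `D`. Then `a' i - a' k = a (ρ i) + a (ρ k)` would be in `D` along with `a (ρ i) - a
  -- (ρ k)`. So `D` would contain all four vectors, three of which are independent.
  have he1 : e' = 1 := by
    rcases mul_self_eq_one_iff.1 ((sq e').symm.trans he') with rfl | rfl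
    · rfl
    exfalso
    obtain ⟨D, hD, hmem⟩ := h.affine
    obtain ⟨D', hD', hmem'⟩ := h'.affine
    have hind : ∀ p q : ℂ, p • (a' i - a' j) + q • (a' k - a' l) = 0 → p = 0 ∧ q = 0 := by
      intro p q hpq
      by_contra hne
      apply hμν
      rw [h'.contactPlane_eq hij hμ', h'.contactPlane_eq hkl hν']
      have hq : q ≠ 0 := by
        rintro rfl
        rw [zero_smul, add_zero] at hpq
        exact hne ⟨(smul_eq_zero.1 hpq).resolve_right (h'.sub_ne_zero hij), rfl⟩
      have hp : p ≠ 0 := by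
        rintro rfl
        rw [zero_smul, zero_add] at hpq
        exact hq ((smul_eq_zero.1 hpq).resolve_right (h'.sub_ne_zero hkl))
      rw [← planeOf_smul hp, eq_neg_of_add_eq_zero_left hpq, ← neg_smul,
        planeOf_smul (neg_ne_zero.2 hq)]
    have hsub : ∀ m n, m ≠ n → a (ρ m) - a (ρ n) ∈ D := fun m n hmn =>
      hmem _ _ fun e => hmn (hρ e)
    obtain ⟨p, q, hpq⟩ := exists_combination_of_mem hD' (hmem' i j hij) (hmem' k l hkl)
      (hmem' i k hik) hind
    rw [hi, hj, hek, hel] at hpq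
    have hsum : a (ρ i) + a (ρ k) ∈ D := by
      have h1 := add_mem (D.smul_mem p (hsub i j hij)) (D.smul_mem (-q) (hsub k l hkl))
      convert h1 using 1
      rw [← sub_eq_zero, ← neg_eq_zero, ← sub_eq_zero.2 hpq]
      module
    have hmi : a (ρ i) ∈ D := by
      have h1 := D.smul_mem (1 / 2) (add_mem hsum (hsub i k hik))
      convert h1 using 1
      module
    have hmm : ∀ m, i ≠ m → a (ρ m) ∈ D := fun m hm => by
      have := sub_mem hmi (hsub i m hm)
      rwa [sub_sub_cancel] at this
    have hdis : ∀ {m n}, m ≠ n → ρ m ≠ ρ n := fun hmn e => hmn (hρ e)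
    obtain ⟨p, q, hpq⟩ := exists_combination_of_mem hD hmi (hmm j hij) (hmm k hik)
      (h.indep_pair (hdis hij))
    have := h.indep _ _ _ (hdis hij) (hdis hik) (hdis hjk) p q (-1) (by rw [hpq]; module)
    simp at this
  rw [he1, one_smul] at hek hel
  have hall : ∀ m, a' m = a (ρ m) := by
    intro m
    rcases Fin.eq_of_four_distinct hij hik hil hjk hjl hkl m with rfl | rfl | rfl | rfl <;>
      assumption
  exact ⟨ρ, hij', fun m => by rw [h.plane, h'.plane, hall],
    fun m n => h.same_of_coords h' hB h0 hρ hall m n⟩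

end Config

/-! ### Generic points and generic quartics -/

open Polynomial

/-- A function on a vector space whose restriction to every affine line is polynomial. -/
def PolyOnLines (f : Coord → ℂ) : Prop := ∀ x v : Coord, ∃ p : ℂ[X], ∀ t : ℂ, f (x + t • v) = p.eval t

namespace PolyOnLines

variable {f g : Coord → ℂ}

theorem const (r : ℂ) : PolyOnLines fun _ => r := fun _ _ => ⟨C r, by simp⟩

theorem linear (φ : Coord →ₗ[ℂ] ℂ) : PolyOnLines fun x => φ x := fun x v =>
  ⟨C (φ x) + X * C (φ v), fun t => by simp; ring⟩

theorem mul (hf : PolyOnLines f) (hg : PolyOnLines g) : PolyOnLines fun x => f x * g x :=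
  fun x v => by
    obtain ⟨p, hp⟩ := hf x v
    obtain ⟨q, hq⟩ := hg x v
    exact ⟨p * q, by simp [hp, hq]⟩

theorem sub (hf : PolyOnLines f) (hg : PolyOnLines g) : PolyOnLines fun x => f x - g x :=
  fun x v => by
    obtain ⟨p, hp⟩ := hf x v
    obtain ⟨q, hq⟩ := hg x v
    exact ⟨p - q, by simp [hp, hq]⟩

theorem quadratic (β : LinearMap.BilinForm ℂ Coord) : PolyOnLines fun x => β x x := fun x v =>
  ⟨C (β x x) + X * C (β x v + β v x) + X ^ 2 * C (β v v), fun t => by simp; ring⟩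

/-- On the line joining a nonzero of `f` to a nonzero of `g` both restrict to nonzero polynomials,
whose product has only finitely many roots. -/
theorem exists_ne_zero (hf : PolyOnLines f) (hg : PolyOnLines g) (hf0 : ∃ x, f x ≠ 0)
    (hg0 : ∃ x, g x ≠ 0) : ∃ x, f x ≠ 0 ∧ g x ≠ 0 := by
  obtain ⟨x, hx⟩ := hf0
  obtain ⟨y, hy⟩ := hg0
  obtain ⟨p, hp⟩ := hf x (y - x)
  obtain ⟨q, hq⟩ := hg x (y - x)
  have hp0 : p ≠ 0 := by
    rintro rfl
    exact hx (by simpa using hp 0)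
  have hq0 : q ≠ 0 := by
    rintro rfl
    exact hy (by simpa using hq 1)
  obtain ⟨t, ht⟩ := ((p * q).rootSet_finite ℂ).infinite_compl.nonempty
  have ht' : (p * q).eval t ≠ 0 := by
    intro h
    exact ht ((mem_rootSet.2 ⟨mul_ne_zero hp0 hq0, by simpa using h⟩))
  rw [eval_mul] at ht'
  exact ⟨x + t • (y - x), by rw [hp]; exact left_ne_zero_of_mul ht',
    by rw [hq]; exact right_ne_zero_of_mul ht'⟩

theorem exists_forall_ne_zero {ι : Type*} (S : Finset ι) {h : ι → Coord → ℂ}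
    (hS : ∀ i ∈ S, PolyOnLines (h i)) (h0 : ∀ i ∈ S, ∃ x, h i x ≠ 0) :
    ∃ x, ∀ i ∈ S, h i x ≠ 0 := by
  classical
  suffices PolyOnLines (fun x => ∏ i ∈ S, h i x) ∧ ∃ x, ∏ i ∈ S, h i x ≠ 0 by
    obtain ⟨-, x, hx⟩ := this
    exact ⟨x, Finset.prod_ne_zero_iff.1 hx⟩
  induction S using Finset.induction_on with
  | empty => simpa using const 1
  | insert i S hi ih =>
    simp only [Finset.mem_insert, forall_eq_or_imp] at hS h0
    obtain ⟨h1, h2⟩ := ih hS.2 h0.2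
    simp only [Finset.prod_insert hi]
    refine ⟨hS.1.mul h1, ?_⟩
    obtain ⟨x, hx, hx'⟩ := exists_ne_zero hS.1 h1 h0.1 h2
    exact ⟨x, mul_ne_zero hx hx'⟩

end PolyOnLines

/-- For a generic middle coefficient a quartic has four distinct roots no two of which have their
product in a given finite set. -/
theorem exists_quartic_roots {f g b c d : ℂ} (hf : f ≠ 0) (hg : g ≠ 0) {S : Set ℂ} (hS : S.Finite)
    (hS0 : ∀ m ∈ S, m ≠ 0) (hSm : ∀ m ∈ S, f * m ^ 2 = g → d ≠ m * b) :
    ∃ τ : ℂ, τ ≠ 0 ∧ ∃ x : Fin 4 → ℂ, Function.Injective x ∧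
      (∀ i, x i ≠ 0) ∧ (∀ i, f * x i ^ 4 + b * x i ^ 3 + (c - τ) * x i ^ 2 + d * x i + g = 0) ∧
      f * ∏ i, x i = g ∧ ∀ i j, i ≠ j → x i * x j ∉ S := by
  -- The quartic says `φ x = τ`. Up to nonzero factors, `P` is the numerator of the derivative of
  -- `φ`, and `R m` that of `φ x - φ (m / x)`. So the values of `φ` at their roots are the `τ`
  -- giving a double root or two roots with product `m`. `R m` is nonzero exactly because `f m² = g`
  -- and `d = m b` do not both hold.
  let φ : ℂ → ℂ := fun x => f * x ^ 2 + b * x + c + d / x + g / x ^ 2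
  let P : ℂ[X] := C (2 * f) * X ^ 4 + C b * X ^ 3 - C d * X - C (2 * g)
  let R : ℂ → ℂ[X] := fun m => C (f * m ^ 2 - g) * X ^ 4 + C (m * (b * m - d)) * X ^ 3 -
    C (m * (m * (b * m - d))) * X - C ((f * m ^ 2 - g) * m ^ 2)
  have hP : P ≠ 0 := by
    intro h
    have := congrArg (fun p => p.coeff 4) h
    simp only [P, coeff_add, coeff_sub, coeff_C_mul, coeff_X_pow, coeff_X, coeff_C] at this
    norm_num [hf] at this
  have hR : ∀ m ∈ S, R m ≠ 0 := by
    intro m hm h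
    have h4 : f * m ^ 2 - g = 0 := by
      have := congrArg (fun p => p.coeff 4) h
      simp only [R, coeff_add, coeff_sub, coeff_C_mul, coeff_X_pow, coeff_X, coeff_C] at this
      norm_num at this
      simpa using this
    have h3 : m * (b * m - d) = 0 := by
      have := congrArg (fun p => p.coeff 3) h
      simp only [R, coeff_add, coeff_sub, coeff_C_mul, coeff_X_pow, coeff_X, coeff_C] at this
      norm_num at this
      simpa using this
    refine hSm m hm (by linear_combination h4) ?_
    have := (mul_eq_zero.1 h3).resolve_left (hS0 m hm)
    linear_combination -this
  have hbad : (φ '' (P.rootSet ℂ ∪ ⋃ m ∈ S, (R m).rootSet ℂ) ∪ {0}).Finite :=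
    (((P.rootSet_finite ℂ).union (hS.biUnion fun m _ => (R m).rootSet_finite ℂ)).image φ).union
      (Set.finite_singleton 0)
  obtain ⟨τ, hτ⟩ := hbad.infinite_compl.nonempty
  simp only [Set.mem_compl_iff, Set.mem_union, Set.mem_singleton_iff, not_or] at hτ
  obtain ⟨hτ1, hτ0⟩ := hτ
  have hφ : ∀ x, x ≠ 0 → f * x ^ 4 + b * x ^ 3 + (c - τ) * x ^ 2 + d * x + g = 0 → φ x = τ := by
    intro x hx h
    simp only [φ]
    field_simp
    linear_combination h
  have hτP : ∀ x, φ x = τ → P.eval x ≠ 0 := by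
    intro x hx h
    exact hτ1 ⟨x, Or.inl (mem_rootSet.2 ⟨hP, by simpa using h⟩), hx⟩
  have hτR : ∀ m ∈ S, ∀ x, φ x = τ → (R m).eval x ≠ 0 := by
    intro m hm x hx h
    refine hτ1 ⟨x, Or.inr ?_, hx⟩
    simp only [Set.mem_iUnion]
    exact ⟨m, hm, mem_rootSet.2 ⟨hR m hm, by simpa using h⟩⟩
  let Q : ℂ[X] := C f * X ^ 4 + C b * X ^ 3 + C (c - τ) * X ^ 2 + C d * X + C g
  have hQe : ∀ x, Q.eval x = f * x ^ 4 + b * x ^ 3 + (c - τ) * x ^ 2 + d * x + g := by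
    intro x; simp [Q]
  have hQd : Q.natDegree = 4 := by
    simp only [Q]; compute_degree!
  have hQ4 : Q.leadingCoeff = f := by
    rw [leadingCoeff, hQd]
    simp only [Q, coeff_add, coeff_C_mul, coeff_X_pow, coeff_X, coeff_C]
    norm_num
  have hQ0 : Q ≠ 0 := by
    intro h
    rw [h] at hQd
    simp at hQd
  have hroot0 : ∀ x, Q.eval x = 0 → x ≠ 0 := by
    rintro x hx rfl
    rw [hQe] at hx
    simp at hx
    exact hg hx
  have hnodup : Q.roots.Nodup := by
    rw [Multiset.nodup_iff_count_le_one]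
    intro x
    rw [count_roots]
    by_contra! hlt
    obtain ⟨h1, h2⟩ := (one_lt_rootMultiplicity_iff_isRoot hQ0).1 hlt
    have hx0 := hroot0 x h1
    have h3 : Q.eval x = 0 := h1
    rw [hQe] at h3
    refine hτP x (hφ x hx0 h3) ?_
    have h4 : (derivative Q).eval x = 0 := h2
    simp [Q] at h4
    simp [P]
    linear_combination x * h4 - 2 * h3
  have hsplit := IsAlgClosed.splits Q
  have hcard : Q.roots.card = 4 := by rw [← hsplit.natDegree_eq_card_roots, hQd]
  have hcard' : Q.roots.toFinset.card = 4 := by rw [Multiset.toFinset_card_of_nodup hnodup, hcard]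
  let e := (Q.roots.toFinset.equivFinOfCardEq hcard').symm
  let x : Fin 4 → ℂ := fun i => (e i : ℂ)
  have hxinj : Function.Injective x := Subtype.val_injective.comp e.injective
  have hxr : ∀ i, Q.eval (x i) = 0 := by
    intro i
    have := (e i).2
    rw [Multiset.mem_toFinset, mem_roots hQ0] at this
    exact this
  have hx0 := fun i => hroot0 _ (hxr i)
  have hxq : ∀ i, f * x i ^ 4 + b * x i ^ 3 + (c - τ) * x i ^ 2 + d * x i + g = 0 := fun i => by
    rw [← hQe]; exact hxr i
  refine ⟨τ, hτ0, x, hxinj, hx0, hxq, ?_, ?_⟩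
  · have h1 := hsplit.eval_eq_prod_roots 0
    have h2 : (Q.roots.map fun a => (0 : ℂ) - a).prod = ∏ i, (0 - x i) := by
      rw [← Equiv.prod_comp e.symm (fun i => (0 - x i))]
      simp only [x, Equiv.apply_symm_apply]
      rw [Finset.prod_coe_sort Q.roots.toFinset (fun a => (0 : ℂ) - a), Finset.prod,
        Multiset.toFinset_val, hnodup.dedup]
    rw [h2, hQ4, hQe, Fin.prod_univ_four] at h1
    rw [Fin.prod_univ_four]
    linear_combination -h1
  · intro i j hij hm
    refine hτR _ hm (x i) (hφ _ (hx0 i) (hxq i)) ?_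
    have hi := hxq i
    have hj := hxq j
    simp [R]
    linear_combination x i ^ 2 * (x j ^ 2 * hi - x i ^ 2 * hj)

/-! ### Choice of the secant and of the plane through it -/

section Existence

variable {A B : Matrix (Fin 4) (Fin 4) ℂ}

theorem exists_toBilin'_ne_zero (hA : A.IsSymm) (hd : A.det ≠ 0) {x : Coord} (hx : x ≠ 0) :
    ∃ y, toBilin' A x y ≠ 0 := by
  by_contra! h
  apply hd
  rw [← exists_mulVec_eq_zero_iff]
  refine ⟨x, hx, ?_⟩
  ext i
  have := h (Pi.single i 1)
  rw [toBilin'_symm hA, toBilin'_apply'] at this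
  simpa using this

theorem exists_orthonormal_basis (hA : A.IsSymm) (hd : A.det ≠ 0) :
    ∃ e : Basis (Fin 4) ℂ Coord, ∀ i j, toBilin' A (e i) (e j) = if i = j then 1 else 0 := by
  have : Invertible (2 : ℂ) := invertibleOfNonzero two_ne_zero
  obtain ⟨v₀, hv₀⟩ := LinearMap.BilinForm.exists_orthogonal_basis (B := toBilin' A)
    ⟨fun x y => by simpa using toBilin'_symm hA x y⟩
  obtain ⟨v, hv⟩ : ∃ v : Basis (Fin 4) ℂ Coord, ∀ i j, i ≠ j → toBilin' A (v i) (v j) = 0 := by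
    refine ⟨v₀.reindex (finCongr (by simp)), fun i j hij => ?_⟩
    rw [Basis.reindex_apply, Basis.reindex_apply]
    exact hv₀ (by simpa using hij)
  have hne : ∀ i, toBilin' A (v i) (v i) ≠ 0 := by
    intro i h0
    obtain ⟨y, hy⟩ := exists_toBilin'_ne_zero hA hd (v.ne_zero i)
    apply hy
    have : toBilin' A (v i) = 0 := by
      apply v.ext
      intro j
      by_cases hij : i = j
      · rw [← hij, h0]; rfl
      · rw [hv i j hij]; rfl
    rw [this]; rfl
  have hroot : ∀ i, ∃ r : ℂˣ, r * (r * toBilin' A (v i) (v i)) = 1 := by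
    intro i
    obtain ⟨r, hr⟩ := IsAlgClosed.exists_pow_nat_eq (toBilin' A (v i) (v i))⁻¹ (n := 2) (by simp)
    have hr0 : r ≠ 0 := by
      rintro rfl
      simp at hr
      exact hne i hr.symm
    refine ⟨Units.mk0 r hr0, ?_⟩
    rw [Units.val_mk0, ← mul_assoc, ← pow_two, hr, inv_mul_cancel₀ (hne i)]
  choose r hr using hroot
  refine ⟨v.unitsSMul r, fun i j => ?_⟩
  rw [Basis.unitsSMul_apply, Basis.unitsSMul_apply, Units.smul_def, Units.smul_def]
  simp only [map_smul, LinearMap.smul_apply, smul_eq_mul]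
  split_ifs with h
  · subst h; exact hr i
  · rw [hv i j h]; simp

/-- Otherwise `B` vanishes on the `A`-isotropic vectors `e i ± I e j` of an orthonormal basis; this
kills its off-diagonal entries and equates its diagonal ones, so `B` is a multiple of `A`. -/
theorem exists_isotropic (hA : A.IsSymm) (hB : B.IsSymm) (hd : A.det ≠ 0)
    (hBA : B ∉ Submodule.span ℂ {A}) : ∃ u, toBilin' A u u = 0 ∧ toBilin' B u u ≠ 0 := by
  by_contra! h
  obtain ⟨e, he⟩ := exists_orthonormal_basis hA hd
  have key : ∀ i j, i ≠ j → toBilin' B (e i) (e j) = 0 ∧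
      toBilin' B (e i) (e i) = toBilin' B (e j) (e j) := by
    intro i j hij
    have hs := toBilin'_symm hB (e j) (e i)
    have h1 := h (e i + Complex.I • e j) (by
      simp [he, hij, hij.symm])
    have h2 := h (e i - Complex.I • e j) (by
      simp [he, hij, hij.symm])
    simp only [map_add, map_sub, map_smul, LinearMap.add_apply, LinearMap.sub_apply,
      LinearMap.smul_apply, smul_eq_mul, hs] at h1 h2
    have hI : Complex.I * Complex.I = -1 := Complex.I_mul_I
    constructor
    · apply mul_left_cancel₀ Complex.I_ne_zero
      linear_combination (1 / 4 : ℂ) * (h1 - h2)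
    · linear_combination (1 / 2 : ℂ) * (h1 + h2) - toBilin' B (e j) (e j) * hI
  apply hBA
  rw [Submodule.mem_span_singleton]
  refine ⟨toBilin' B (e 0) (e 0), ?_⟩
  apply toBilin'.injective
  rw [map_smul]
  apply LinearMap.BilinForm.ext_basis e
  intro i j
  simp only [LinearMap.smul_apply, he, smul_eq_mul]
  split_ifs with hij
  · subst hij
    by_cases h0 : 0 = i
    · rw [h0]; simp
    · rw [(key 0 i h0).2]; simp
  · rw [(key i j hij).1]; simp

theorem exists_orthogonal_not_isotropic (hA : A.IsSymm) (hd : A.det ≠ 0) {u : Coord}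
    (hu : u ≠ 0) : ∃ p, toBilin' A u p = 0 ∧ toBilin' A p p ≠ 0 := by
  by_contra! h
  obtain ⟨e, he⟩ := exists_orthonormal_basis hA hd
  -- The test vectors are orthogonal to `u`. Three squares whose pairwise sums vanish are all zero,
  -- so `u` would be in the radical of `A`.
  have key : ∀ i j, i ≠ j → toBilin' A u (e i) ^ 2 + toBilin' A u (e j) ^ 2 = 0 := by
    intro i j hij
    have := h (toBilin' A u (e i) • e j - toBilin' A u (e j) • e i) (by simp; ring)
    simp [he, hij, hij.symm] at this
    linear_combination this
  have hz : ∀ i, toBilin' A u (e i) = 0 := by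
    intro i
    obtain ⟨j, k, hij, hik, hjk⟩ : ∃ j k : Fin 4, i ≠ j ∧ i ≠ k ∧ j ≠ k := by
      revert i; decide
    apply pow_eq_zero_iff (two_ne_zero) |>.1
    linear_combination (1 / 2 : ℂ) * (key i j hij + key i k hik - key j k hjk)
  obtain ⟨y, hy⟩ := exists_toBilin'_ne_zero hA hd hu
  have : toBilin' A u = 0 := e.ext fun i => by rw [hz i]; rfl
  exact hy (by rw [this]; rfl)

/-- These are roots of the characteristic polynomial of `-A⁻¹ B`. -/
theorem finite_setOf_det_eq_zero (hd : A.det ≠ 0) : {s : ℂ | (B + s • A).det = 0}.Finite := by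
  have hfin := (-(A⁻¹ * B)).charpoly.rootSet_finite ℂ
  refine hfin.subset fun s hs => mem_rootSet.2 ⟨(charpoly_monic _).ne_zero, ?_⟩
  have h1 : (scalar (Fin 4) s - -(A⁻¹ * B)) = A⁻¹ * (B + s • A) := by
    rw [mul_add, Matrix.mul_smul, nonsing_inv_mul _ (Ne.isUnit hd), sub_neg_eq_add, add_comm]
    simp [Matrix.smul_one_eq_diagonal]
  rw [coe_aeval_eq_eval, eval_charpoly, h1, det_mul, show (B + s • A).det = 0 from hs, mul_zero]

/-- The form of a symmetric matrix of rank at least two is not a multiple of the square of the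
linear form polar to `u`. -/
theorem exists_gram_ne_zero {M : Matrix (Fin 4) (Fin 4) ℂ} (hM : M.IsSymm) (hr : 2 ≤ M.rank)
    {u : Coord} (hu : toBilin' M u u ≠ 0) :
    ∃ y, toBilin' M u u * toBilin' M y y - toBilin' M u y * toBilin' M u y ≠ 0 := by
  by_contra! h
  have hpol : ∀ y z, toBilin' M u u * toBilin' M y z = toBilin' M u y * toBilin' M u z := by
    intro y z
    have h1 := h (y + z)
    have h2 := h y
    have h3 := h z
    have hs := toBilin'_symm hM z y
    simp only [map_add, LinearMap.add_apply, hs] at h1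
    linear_combination (1 / 2 : ℂ) * (h1 - h2 - h3)
  have hMv : M = vecMulVec ((toBilin' M u u)⁻¹ • M *ᵥ u) (M *ᵥ u) := by
    ext i j
    have h1 := hpol (Pi.single i 1) (Pi.single j 1)
    rw [toBilin'_symm hM u (Pi.single i 1), toBilin'_symm hM u (Pi.single j 1), toBilin'_single]
      at h1
    have hi : ∀ i, toBilin' M (Pi.single i 1) u = (M *ᵥ u) i := fun i => by
      rw [toBilin'_apply']; simp
    rw [hi, hi] at h1
    rw [vecMulVec_apply, Pi.smul_apply, smul_eq_mul]
    field_simp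
    linear_combination h1
  have := rank_vecMulVec_le ((toBilin' M u u)⁻¹ • M *ᵥ u) (M *ᵥ u)
  rw [← hMv] at this
  omega

/-- A generic secant of the quadric `A` with respect to the pencil spanned by `A` and `B`. -/
theorem exists_secant (hA : A.IsSymm) (hB : B.IsSymm) (hd : A.det ≠ 0)
    (hBA : B ∉ Submodule.span ℂ {A}) (hrank : ∀ s : ℂ, 2 ≤ (B + s • A).rank) :
    ∃ u v, toBilin' A u u = 0 ∧ toBilin' A v v = 0 ∧ toBilin' A u v = 1 ∧
      toBilin' B u u ≠ 0 ∧ toBilin' B v v ≠ 0 ∧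
      ∀ s : ℂ, (B + s • A).det = 0 →
        (toBilin' B u v + s) ^ 2 ≠ toBilin' B u u * toBilin' B v v := by
  obtain ⟨u, hu, hBu⟩ := exists_isotropic hA hB hd hBA
  have hu0 : u ≠ 0 := by
    rintro rfl
    simp at hBu
  have hfin := finite_setOf_det_eq_zero (A := A) (B := B) hd
  have hsymm : ∀ s : ℂ, (B + s • A).IsSymm := fun s => hB.add (hA.smul s)
  have hu' : ∀ s : ℂ, toBilin' (B + s • A) u u = toBilin' B u u := fun s => by simp [hu]
  -- This is the second intersection of the line `u y` with the quadric `A`; `v` is its multiple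
  -- with `A u v = 1`.
  let v₀ : Coord → Coord := fun y => (2 * toBilin' A u y) • y - toBilin' A y y • u
  have hv₀ : ∀ y, toBilin' B (v₀ y) (v₀ y) =
      4 * (toBilin' A u y * toBilin' A u y) * toBilin' B y y -
      4 * (toBilin' A u y * toBilin' A y y) * toBilin' B u y -
      (-1) * (toBilin' A y y * toBilin' A y y) * toBilin' B u u := by
    intro y
    have hs := toBilin'_symm hB y u
    simp only [v₀, map_sub, map_smul, LinearMap.sub_apply, LinearMap.smul_apply, smul_eq_mul, hs]
    ring
  have hpA := PolyOnLines.linear (toBilin' A u)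
  have hpQ := PolyOnLines.quadratic (toBilin' A)
  have hp₀ : PolyOnLines fun y => toBilin' B (v₀ y) (v₀ y) := by
    simp only [hv₀]
    exact ((((PolyOnLines.const 4).mul (hpA.mul hpA)).mul (PolyOnLines.quadratic _)).sub
      (((PolyOnLines.const 4).mul (hpA.mul hpQ)).mul (PolyOnLines.linear _))).sub
      (((PolyOnLines.const (-1)).mul (hpQ.mul hpQ)).mul (PolyOnLines.const _))
  obtain ⟨p, hp, hpp⟩ := exists_orthogonal_not_isotropic hA hd hu0
  have hne₀ : ∃ y, toBilin' B (v₀ y) (v₀ y) ≠ 0 := by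
    refine ⟨p, ?_⟩
    rw [hv₀, hp]
    simp [hpp, hBu]
  let G : ℂ → Coord → ℂ := fun s y => toBilin' (B + s • A) u u * toBilin' (B + s • A) y y -
    toBilin' (B + s • A) u y * toBilin' (B + s • A) u y
  let H : Option (Option ℂ) → Coord → ℂ := fun o y => match o with
    | none => toBilin' A u y
    | some none => toBilin' B (v₀ y) (v₀ y)
    | some (some s) => G s y
  obtain ⟨y, hy⟩ := PolyOnLines.exists_forall_ne_zero
    (Finset.insertNone (Finset.insertNone hfin.toFinset)) (h := H) (by
      rintro (_ | _ | s) -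
      · exact hpA
      · exact hp₀
      · exact ((PolyOnLines.const _).mul (PolyOnLines.quadratic _)).sub
          ((PolyOnLines.linear _).mul (PolyOnLines.linear _))) (by
      rintro (_ | _ | s) -
      · exact exists_toBilin'_ne_zero hA hd hu0
      · exact hne₀
      · exact exists_gram_ne_zero (hsymm s) (hrank s) (by rw [hu' s]; exact hBu))
  have hy1 : toBilin' A u y ≠ 0 := hy none (by simp)
  have hy2 : toBilin' B (v₀ y) (v₀ y) ≠ 0 := hy (some none) (by simp)
  have hy3 : ∀ s : ℂ, (B + s • A).det = 0 → G s y ≠ 0 := fun s hs =>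
    hy (some (some s)) (by simpa using hs)
  have hr0 : 2 * toBilin' A u y ^ 2 ≠ 0 := mul_ne_zero two_ne_zero (pow_ne_zero 2 hy1)
  have hsy := toBilin'_symm hA y u
  have hsyB := toBilin'_symm hB y u
  refine ⟨u, (2 * toBilin' A u y ^ 2)⁻¹ • v₀ y, hu, ?_, ?_, hBu, ?_, fun s hs heq => ?_⟩
  · simp only [v₀, map_sub, map_smul, LinearMap.sub_apply, LinearMap.smul_apply, smul_eq_mul, hsy,
      hu]
    ring
  · simp only [v₀, map_sub, map_smul, smul_eq_mul, hu]
    field_simp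
    ring
  · simp only [map_smul, LinearMap.smul_apply, smul_eq_mul]
    exact mul_ne_zero (inv_ne_zero hr0) (mul_ne_zero (inv_ne_zero hr0) hy2)
  · apply hy3 s hs
    simp only [v₀, map_sub, map_smul, LinearMap.sub_apply, LinearMap.smul_apply, smul_eq_mul, hsyB]
      at heq
    simp only [G, map_add, map_smul, LinearMap.add_apply, LinearMap.smul_apply, smul_eq_mul, hu]
    generalize toBilin' A u y = α at *
    generalize toBilin' A y y = κ at *
    generalize toBilin' B u y = β at *
    generalize toBilin' B y y = γ at *
    generalize toBilin' B u u = δ at *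
    -- Up to multiples of `u`, `v` is `α⁻¹ y`, so the Gram determinant of `B + s A` on `u, v` is
    -- `α⁻²` times that on `u, y`, which was chosen nonzero.
    have key : ((2 * α ^ 2)⁻¹ * (2 * α * β - κ * δ) + s) ^ 2 -
        δ * ((2 * α ^ 2)⁻¹ * ((2 * α ^ 2)⁻¹ *
          (2 * α * (2 * α * γ - κ * β) - κ * (2 * α * β - κ * δ)))) =
        -(α ^ 2)⁻¹ * ((δ + s * 0) * (γ + s * κ) - (β + s * α) * (β + s * α)) := by
      field_simp
      ring
    rw [sub_eq_zero.2 (heq.trans (by ring))] at key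
    simpa [hy1] using key.symm

/-- A vector orthogonal to a secant whose span with it is a generic plane. -/
theorem exists_orthogonal_to_secant (hA : A.IsSymm) (hB : B.IsSymm) (hd : A.det ≠ 0) {u v : Coord}
    (hu : toBilin' A u u = 0) (hv : toBilin' A v v = 0) (huv : toBilin' A u v = 1)
    (hBu : toBilin' B u u ≠ 0)
    (hdet : ∀ s : ℂ, (B + s • A).det = 0 →
      (toBilin' B u v + s) ^ 2 ≠ toBilin' B u u * toBilin' B v v) :
    ∃ w, toBilin' A w u = 0 ∧ toBilin' A w v = 0 ∧ toBilin' A w w = -2 ∧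
      ∀ m : ℂ, toBilin' B u u * m ^ 2 = toBilin' B v v →
        toBilin' B w v ≠ m * toBilin' B w u := by
  have hvu : toBilin' A v u = 1 := by rw [toBilin'_symm hA, huv]
  -- Orthogonal projection onto the complement of the secant.
  let L : Coord →ₗ[ℂ] Coord :=
    LinearMap.id - (toBilin' A v).smulRight u - (toBilin' A u).smulRight v
  have hL : ∀ y, L y = y - toBilin' A v y • u - toBilin' A u y • v := fun y => by simp [L]
  have hLu : ∀ y, toBilin' A (L y) u = 0 := fun y => by
    have := toBilin'_symm hA y u
    simp [hL, hu, hvu, this]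
  have hLv : ∀ y, toBilin' A (L y) v = 0 := fun y => by
    have := toBilin'_symm hA y v
    simp [hL, hv, huv, this]
  have hne₁ : ∃ y, ((toBilin' A).comp L L) y y ≠ 0 := by
    by_contra! h
    simp only [LinearMap.BilinForm.comp_apply] at h
    have hker : LinearMap.ker ((toBilin' A u).prod (toBilin' A v)) ≠ ⊥ :=
      LinearMap.ker_ne_bot_of_finrank_lt (by simp)
    obtain ⟨y, hy, hy0⟩ := Submodule.exists_mem_ne_zero_of_ne_bot hker
    replace hy : toBilin' A u y = 0 ∧ toBilin' A v y = 0 := Prod.mk_eq_zero.1 hy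
    obtain ⟨z, hz⟩ := exists_toBilin'_ne_zero hA hd hy0
    have hLy : L y = y := by simp [hL, hy.1, hy.2]
    have h1 := h (y + z)
    have h2 := h y
    have h3 := h z
    have hs := toBilin'_symm hA (L z) (L y)
    simp only [map_add, LinearMap.add_apply, hs] at h1
    have h4 : toBilin' A (L y) (L z) = 0 := by linear_combination (1 / 2 : ℂ) * (h1 - h2 - h3)
    rw [hLy, hL] at h4
    have e1 := toBilin'_symm hA y u
    have e2 := toBilin'_symm hA y v
    simp [e1, e2, hy.1, hy.2] at h4
    exact hz h4
  have hne₂ : ∀ m : ℂ, toBilin' B u u * m ^ 2 = toBilin' B v v →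
      ∃ y, ((toBilin' B (v - m • u)).comp L) y ≠ 0 := by
    intro m hm
    by_contra! h
    simp only [LinearMap.comp_apply] at h
    have hBvu := toBilin'_symm hB v u
    -- If `v - m u` were `B`-orthogonal to the whole complement of the secant, it would lie in the
    -- kernel of `B + s A` for this `s`. That member would be singular with `(B u v + s)² = B u u *
    -- B v v`, contrary to the choice of the secant.
    refine hdet (m * toBilin' B u u - toBilin' B u v) ?_ ?_
    · rw [← exists_mulVec_eq_zero_iff]
      refine ⟨v - m • u, fun h0 => ?_, ?_⟩
      · have := congrArg (toBilin' A u) h0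
        simp [hu, huv] at this
      have hall : ∀ y, toBilin' (B + (m * toBilin' B u u - toBilin' B u v) • A) y (v - m • u)
          = 0 := by
        intro y
        have hy : y = L y + toBilin' A v y • u + toBilin' A u y • v := by rw [hL]; abel
        rw [toBilin'_symm (hB.add (hA.smul _))]
        have h1 := h y
        have e1 := toBilin'_symm hA v (L y)
        have e2 := toBilin'_symm hA u (L y)
        conv_lhs => rw [hy]
        simp only [map_add, map_sub, map_smul, LinearMap.add_apply, LinearMap.sub_apply,
          LinearMap.smul_apply, smul_eq_mul, e1, e2, hLu, hLv, hu, hv, huv, hvu, hBvu] at h1 ⊢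
        linear_combination h1 - toBilin' A u y * hm
      ext i
      have := hall (Pi.single i 1)
      rw [toBilin'_apply'] at this
      simpa using this
    · linear_combination toBilin' B u u * hm
  obtain ⟨m₀, hm₀⟩ := IsAlgClosed.exists_pow_nat_eq (toBilin' B v v / toBilin' B u u) (n := 2)
    (by simp)
  have hm : toBilin' B u u * m₀ ^ 2 = toBilin' B v v := by rw [hm₀]; field_simp
  have hm' : toBilin' B u u * (-m₀) ^ 2 = toBilin' B v v := by rw [neg_sq, hm]
  obtain ⟨y, hy⟩ := PolyOnLines.exists_ne_zero ((PolyOnLines.quadratic ((toBilin' A).comp L L)).mul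
      (PolyOnLines.linear ((toBilin' B (v - m₀ • u)).comp L)))
    (PolyOnLines.linear ((toBilin' B (v - (-m₀) • u)).comp L)) (by
      obtain ⟨y, h1, h2⟩ := PolyOnLines.exists_ne_zero
        (PolyOnLines.quadratic ((toBilin' A).comp L L))
        (PolyOnLines.linear ((toBilin' B (v - m₀ • u)).comp L)) hne₁ (hne₂ _ hm)
      exact ⟨y, mul_ne_zero h1 h2⟩) (hne₂ _ hm')
  obtain ⟨hy12, hy3⟩ := hy
  have hy1 : toBilin' A (L y) (L y) ≠ 0 := left_ne_zero_of_mul hy12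
  have hy2 : toBilin' B (v - m₀ • u) (L y) ≠ 0 := right_ne_zero_of_mul hy12
  have hy3 : toBilin' B (v - (-m₀) • u) (L y) ≠ 0 := hy3
  obtain ⟨r, hr⟩ := IsAlgClosed.exists_pow_nat_eq (-2 / toBilin' A (L y) (L y)) (n := 2) (by simp)
  have hr0 : r ≠ 0 := by
    rintro rfl
    have : (-2 : ℂ) / toBilin' A (L y) (L y) ≠ 0 := div_ne_zero (by simp) hy1
    exact this (by rw [← hr]; simp)
  refine ⟨r • L y, by simp [hLu], by simp [hLv], ?_, ?_⟩
  · simp only [map_smul, LinearMap.smul_apply, smul_eq_mul]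
    rw [← mul_assoc, ← sq, hr]
    field_simp
  · intro m hmm heq
    simp only [map_smul, LinearMap.smul_apply, smul_eq_mul] at heq
    have h1 : toBilin' B (L y) v = m * toBilin' B (L y) u := by
      apply mul_left_cancel₀ hr0
      linear_combination heq
    rw [toBilin'_symm hB, toBilin'_symm hB (L y)] at h1
    have h2 : m ^ 2 = m₀ ^ 2 := mul_left_cancel₀ hBu (hmm.trans hm.symm)
    rcases sq_eq_sq_iff_eq_or_eq_neg.1 h2 with rfl | rfl
    · exact hy2 (by simp [h1])
    · exact hy3 (by simp [h1])

end Existence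

/-! ### Construction of the configuration -/

theorem finite_setOf_quadratic {f g β : ℂ} (hf : f ≠ 0) {S : Set ℂ} (hS : S.Finite) :
    {m : ℂ | m ≠ 0 ∧ ∃ s ∈ S, f * m ^ 2 + g = 2 * (s + β) * m}.Finite := by
  let P : ℂ → ℂ[X] := fun s => C f * X ^ 2 - C (2 * (s + β)) * X + C g
  have hP : ∀ s, P s ≠ 0 := by
    intro s h
    have := congrArg (fun p => p.coeff 2) h
    simp only [P, coeff_add, coeff_sub, coeff_C_mul, coeff_X_pow, coeff_X, coeff_C] at this
    norm_num [hf] at this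
  refine (hS.biUnion fun s _ => (P s).rootSet_finite ℂ).subset ?_
  rintro m ⟨-, s, hs, h⟩
  simp only [Set.mem_iUnion]
  refine ⟨s, hs, mem_rootSet.2 ⟨hP s, ?_⟩⟩
  simp only [coe_aeval_eq_eval, P, eval_add, eval_sub, eval_mul, eval_C, eval_pow, eval_X]
  linear_combination h

theorem pairIndex_ne_zero : ∀ i j : Fin 4, i ≠ j → pairIndex i j ≠ 0 := by decide

/-- Two roots and the two remaining ones lead to the same quadric of the pencil. -/
theorem mul_eq_or_mul_mul_eq (x : Fin 4 → ℂ) (i j : Fin 4) (hij : i ≠ j) :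
    x i * x j = x 0 * x (pairIndex i j) ∨
      x i * x j * (x 0 * x (pairIndex i j)) = ∏ n, x n := by
  rw [Fin.prod_univ_four]
  have hp : pairIndex = ![![0, 1, 2, 3], ![1, 0, 3, 2], ![2, 3, 0, 1], ![3, 2, 1, 0]] := rfl
  rw [hp]
  fin_cases i <;> fin_cases j <;> simp at hij ⊢ <;> first | done | (left; ring1) | (right; ring1)

/-- Every quadric of a dual pencil without matrices of rank one occurs in a general configuration. -/
theorem DualPencil.exists_config (F : DualPencil) (hF : ∀ B ∈ F.forms, B ≠ 0 → 2 ≤ B.rank)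
    (Γ₀ : Quadric) (h₀ : F.Has Γ₀) :
    ∃ c : Config, c.quadric 0 = Γ₀ ∧ c.IsLebesgue F ∧ c.IsGeneral F := by
  obtain ⟨B, hBF, hBA⟩ := F.exists_not_mem_span Γ₀.mat⁻¹
  have hB := F.symm B hBF
  have hA := Γ₀.inv_symm
  have hd := Γ₀.inv_det
  have hAF : Γ₀.mat⁻¹ ∈ F.forms := h₀
  have hdual : Γ₀.dual = toBilin' Γ₀.mat⁻¹ := rfl
  have hA0 := Γ₀.inv_ne_zero
  have hmemF : ∀ s : ℂ, B + s • Γ₀.mat⁻¹ ∈ F.forms := fun s =>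
    add_mem hBF (F.forms.smul_mem _ hAF)
  have hcomb := fun {M} (hM : M ∈ F.forms) => DualPencil.exists_combination hAF hBF hA0 hBA hM
  have hsame := fun Γ' : Quadric => Γ₀.same_iff Γ'
  have htan := fun {a : Coord} (ha : a ≠ 0) => Γ₀.isTangentPlane_planeOf ha
  rw [hdual] at htan
  generalize Γ₀.mat⁻¹ = A at *
  obtain ⟨u, v, hu, hv, huv, hBu, hBv, hdet⟩ := exists_secant hA hB hd hBA (fun s =>
    hF _ (hmemF s) (fun h => hBA (Submodule.mem_span_singleton.2 ⟨-s, by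
      rw [neg_smul]; exact (eq_neg_of_add_eq_zero_left h).symm⟩)))
  obtain ⟨w, hwu, hwv, hww, hwm⟩ := exists_orthogonal_to_secant hA hB hd hu hv huv hBu hdet
  have hvu := (toBilin'_symm hA v u).trans huv
  have huw := (toBilin'_symm hA u w).trans hwu
  have hvw := (toBilin'_symm hA v w).trans hwv
  have hBvu := toBilin'_symm hB v u
  have hBuw := toBilin'_symm hB u w
  have hBvw := toBilin'_symm hB v w
  obtain ⟨f, hf⟩ : ∃ f, f = toBilin' B u u := ⟨_, rfl⟩
  obtain ⟨g, hg⟩ : ∃ g, g = toBilin' B v v := ⟨_, rfl⟩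
  obtain ⟨β, hβ⟩ : ∃ β, β = toBilin' B u v := ⟨_, rfl⟩
  rw [← hf] at hBu hwm
  rw [← hg] at hBv hwm
  have hfin := finite_setOf_quadratic (f := f) (g := g) (β := β) hBu
    (finite_setOf_det_eq_zero (A := A) (B := B) hd)
  obtain ⟨τ, hτ, x, hinj, hx0, hx, hprod, hS⟩ := exists_quartic_roots (f := f) (g := g)
    (b := 2 * toBilin' B w u) (c := toBilin' B w w + 2 * β) (d := 2 * toBilin' B w v) hBu hBv hfin
    (fun m hm => hm.1) (fun m _ hfm h => hwm m hfm (by linear_combination (1 / 2 : ℂ) * h))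
  let a : Fin 4 → Coord := fun i => w + x i • u + (x i)⁻¹ • v
  -- With `m = x i * x j`, the difference `a i - a j` is `(x i - x j)(u - m⁻¹ v)` and `A (a i) (a j)
  -- = (x i - x j)² / m`. Equating `B (a i) (a j) + s A (a i) (a j)` with `τ` gives this `s`. It is
  -- unchanged under `m ↦ g / (f m)`, that is, on passing to the complementary pair of roots.
  let s : Fin 4 → ℂ := fun k => (f * (x 0 * x k) + g / (x 0 * x k)) / 2 - β
  have hs : ∀ k, 0 ≠ k → (B + s k • A).det ≠ 0 := by
    intro k hk hdet0
    refine hS 0 k hk ⟨mul_ne_zero (hx0 0) (hx0 k), s k, hdet0, ?_⟩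
    have h1 := hx0 0
    have h2 := hx0 k
    simp only [s]
    field_simp
    ring
  have hAa : ∀ i j, toBilin' A (a i) (a j) = (x i - x j) ^ 2 / (x i * x j) := by
    intro i j
    have h1 := hx0 i
    have h2 := hx0 j
    simp only [a, map_add, map_smul, LinearMap.add_apply, LinearMap.smul_apply, smul_eq_mul,
      hu, hv, huv, hvu, hwu, hwv, huw, hvw, hww]
    field_simp
    ring
  have hAii : ∀ i, toBilin' A (a i) (a i) = 0 := fun i => by rw [hAa]; simp
  have hAij : ∀ i j, i ≠ j → toBilin' A (a i) (a j) ≠ 0 := by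
    intro i j hij
    rw [hAa]
    exact div_ne_zero (pow_ne_zero 2 (sub_ne_zero.2 fun h => hij (hinj h)))
      (mul_ne_zero (hx0 i) (hx0 j))
  have hBa : ∀ i j, toBilin' B (a i) (a j) = toBilin' B w w + toBilin' B w u * (x i + x j) +
      toBilin' B w v * ((x i)⁻¹ + (x j)⁻¹) + f * (x i * x j) + g * ((x i)⁻¹ * (x j)⁻¹) +
      β * (x i * (x j)⁻¹ + x j * (x i)⁻¹) := by
    intro i j
    simp only [a, map_add, map_smul, LinearMap.add_apply, LinearMap.smul_apply, smul_eq_mul,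
      hBvu, hBuw, hBvw, ← hf, ← hg, ← hβ]
    ring
  have hBii : ∀ i, toBilin' B (a i) (a i) = τ := by
    intro i
    have h1 := hx0 i
    rw [hBa]
    field_simp
    linear_combination hx i
  have hBs : ∀ i j, i ≠ j →
      toBilin' B (a i) (a j) + s (pairIndex i j) * toBilin' A (a i) (a j) = τ := by
    intro i j hij
    have h1 := hx0 i
    have h2 := hx0 j
    have hsk : s (pairIndex i j) = (f * (x i * x j) + g / (x i * x j)) / 2 - β := by
      have h3 := hx0 0
      have h4 := hx0 (pairIndex i j)
      rcases mul_eq_or_mul_mul_eq x i j hij with h | h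
      · simp only [s, h]
      · rw [← h] at hprod
        simp only [s]
        rw [← hprod]
        field_simp
        ring
    have e : τ = (toBilin' B (a i) (a i) + toBilin' B (a j) (a j)) / 2 := by
      rw [hBii, hBii]; ring
    rw [e, hsk, hAa, hBa, hBa, hBa]
    field_simp
    ring
  have ha0 : ∀ i, a i ≠ 0 := by
    intro i h
    apply hτ
    rw [← hBii i, h]
    simp
  -- Three isotropic vectors with nonzero mutual products have the nonzero Gram determinant `2 A (a
  -- i) (a j) A (a i) (a k) A (a j) (a k)`.
  have hindep : ∀ i j k, i ≠ j → i ≠ k → j ≠ k → ∀ p q : ℂ, p • a i + q • a j ≠ a k := by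
    intro i j k hij hik hjk p q h
    have e1 := congrArg (toBilin' A (a i)) h
    have e2 := congrArg (toBilin' A (a j)) h
    have e3 := congrArg (toBilin' A (a k)) h
    have f1 := toBilin'_symm hA (a j) (a i)
    have f2 := toBilin'_symm hA (a k) (a i)
    have f3 := toBilin'_symm hA (a k) (a j)
    simp only [map_add, map_smul, smul_eq_mul, hAii, f1, f2, f3] at e1 e2 e3
    have : 2 * (toBilin' A (a i) (a k) * toBilin' A (a j) (a k)) = 0 := by
      linear_combination toBilin' A (a i) (a j) * e3 - toBilin' A (a i) (a k) * e2 -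
        toBilin' A (a j) (a k) * e1
    simp [hAij i k hik, hAij j k hjk] at this
  have hpair : ∀ i j, i ≠ j → LinearIndependent ℂ ![a i, a j] := by
    intro i j hij
    rw [LinearIndependent.pair_iff' (ha0 i)]
    intro r hr
    apply hAij i j hij
    rw [← hr]
    simp [hAii]
  let Q : Fin 4 → Quadric := fun k =>
    if h : 0 = k then Γ₀ else Quadric.ofDual _ (F.symm _ (hmemF (s k))) (hs k h)
  have hQ0 : Q 0 = Γ₀ := by simp [Q]
  have hQ : ∀ k, 0 ≠ k → (Q k).mat⁻¹ = B + s k • A := by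
    intro k hk
    simp only [Q, dif_neg hk]
    exact Quadric.ofDual_inv _ _ _
  let c : Config := ⟨fun i => planeOf (a i), Q⟩
  have hD : finrank ℂ (Submodule.span ℂ {u, v}) = 2 := by
    have hli : LinearIndependent ℂ ![u, v] := by
      rw [LinearIndependent.pair_iff' (by rintro rfl; simp at huv)]
      rintro r rfl
      simp [hu] at huv
    have := finrank_span_eq_card hli
    rwa [Matrix.range_cons_cons_empty] at this
  refine ⟨c, hQ0, ⟨?_, ?_, ?_, ann (Submodule.span ℂ {u, v}), ?_, ?_⟩, ?_⟩
  · intro k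
    change F.Has (Q k)
    by_cases hk : 0 = k
    · rw [← hk, hQ0]; exact h₀
    · rw [DualPencil.Has, hQ k hk]; exact hmemF _
  · intro i
    change (Q 0).IsTangentPlane (planeOf (a i))
    rw [hQ0, htan (ha0 i)]
    exact hAii i
  · intro i j k hij hik hjk hle
    change planeOf (a i) ⊓ planeOf (a j) ≤ planeOf (a k) at hle
    rw [planeOf_inf_planeOf, ann_le_planeOf, Submodule.mem_span_pair] at hle
    obtain ⟨p, q, h⟩ := hle
    exact hindep i j k hij hik hjk p q h
  · rw [finrank_ann, hD]
  · intro i j hij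
    have hdu : ∀ y z, (Q (pairIndex i j)).dual y z =
        toBilin' B y z + s (pairIndex i j) * toBilin' A y z := by
      intro y z
      rw [Quadric.dual, hQ _ (pairIndex_ne_zero i j hij).symm]
      simp
    refine ⟨planeOf ((1 : ℂ) • a i + (-1 : ℂ) • a j), ?_, ?_⟩
    · change (Q (pairIndex i j)).Touches (planeOf (a i) ⊓ planeOf (a j)) _
      rw [Quadric.touches_iff _ (hpair i j hij)]
      refine ⟨1, -1, fun h => ?_, rfl, ?_, ?_, ?_⟩
      · have := LinearIndependent.pair_iff.1 (hpair i j hij) _ _ h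
        simp at this
      · simp only [map_add, map_smul, smul_eq_mul, hdu, hBii, hAii]
        linear_combination -hBs i j hij
      · rw [(Q (pairIndex i j)).dual_symm]
        simp only [map_add, map_smul, LinearMap.add_apply, LinearMap.smul_apply, smul_eq_mul, hdu,
          hBs i j hij, hBii, hAii]
        ring
      · rintro ⟨h, -⟩
        rw [hdu, hBii, hAii] at h
        exact hτ (by linear_combination h)
    · rw [ann_le_planeOf, Submodule.mem_span_pair]
      refine ⟨x i - x j, (x i)⁻¹ - (x j)⁻¹, ?_⟩
      simp only [a]
      module
  · intro i Γ hΓ ht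
    change Γ.IsTangentPlane (planeOf (a i)) at ht
    change (Q 0).Same Γ
    rw [hQ0, hsame]
    rw [Γ.isTangentPlane_planeOf (ha0 i), Quadric.dual] at ht
    obtain ⟨p, q, hpq⟩ := hcomb hΓ
    rw [hpq] at ht
    simp only [map_add, map_smul, LinearMap.add_apply, LinearMap.smul_apply, smul_eq_mul, hBii,
      hAii] at ht
    -- At `a i` the form `p B + q A` equals `p τ`, so tangency leaves only multiples of `A`; this is
    -- why `τ ≠ 0` was required.
    have hp : p = 0 := by simpa [hτ] using ht
    rw [hp, zero_smul, zero_add] at hpq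
    refine ⟨q, ?_, hpq⟩
    rintro rfl
    exact Γ.inv_ne_zero (by rw [hpq, zero_smul])

end

theorem mainTheorem7 (F : DualPencil) :
    -- existence, for every quadric `Γ₀` of a dual pencil without double points
    ((∀ B ∈ F.forms, B ≠ 0 → 2 ≤ B.rank) →
      ∀ Γ₀ : Quadric, F.Has Γ₀ →
        ∃ c : Config, c.quadric 0 = Γ₀ ∧ c.IsLebesgue F ∧ c.IsGeneral F) ∧
    -- the six lines of intersection belong to one bundle
    (∀ c : Config, c.IsLebesgue F →
      ∃ x : Coord, x ≠ 0 ∧ ∀ i j, i ≠ j → x ∈ c.line i j) ∧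
    -- two adjacent lines and their tangent planes determine everything
    (∀ c c' : Config, c.IsLebesgue F → c.IsGeneral F → c'.IsLebesgue F → c'.IsGeneral F →
      ∀ i j k : Fin 4, i ≠ j → i ≠ k → j ≠ k →
        c.line i j = c'.line i j → c.line i k = c'.line i k →
        ∀ μ τ : Submodule ℂ Coord,
          c.IsContactPlane i j μ → c'.IsContactPlane i j μ →
          c.IsContactPlane i k τ → c'.IsContactPlane i k τ →
          (∀ a, c'.plane a = c.plane a) ∧ ∀ a, (c.quadric a).Same (c'.quadric a)) ∧
    -- two opposite lines and their (distinct) tangent planes determine, for a given `Γ₀`,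
    -- everything up to interchanging the two planes through either line
    (∀ c c' : Config, c.IsLebesgue F → c.IsGeneral F → c'.IsLebesgue F → c'.IsGeneral F →
      (c.quadric 0).Same (c'.quadric 0) →
      ∀ i j k l : Fin 4, i ≠ j → i ≠ k → i ≠ l → j ≠ k → j ≠ l → k ≠ l →
        c.line i j = c'.line i j → c.line k l = c'.line k l →
        ∀ μ ν : Submodule ℂ Coord, μ ≠ ν →
          c.IsContactPlane i j μ → c'.IsContactPlane i j μ →
          c.IsContactPlane k l ν → c'.IsContactPlane k l ν →
          ∃ σ : Equiv.Perm (Fin 4),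
            ((σ i = i ∧ σ j = j) ∨ (σ i = j ∧ σ j = i)) ∧
            (∀ a, c'.plane a = c.plane (σ a)) ∧
            ∀ a b, (c.quadric (pairIndex (σ a) (σ b))).Same (c'.quadric (pairIndex a b))) := by
  refine ⟨F.exists_config, fun c hc => hc.exists_common_point, ?_, ?_⟩
  · intro c c' hc hg hc' hg' i j k hij hik hjk hl hl' μ τ hμ hμ' hτ hτ'
    exact Config.eq_of_adjacent_lines hc hg hc' hg' hij hik hjk hl hl' hμ hμ' hτ hτ'
  · intro c c' hc hg hc' hg' h0 i j k l hij hik hil hjk hjl hkl hl hl' μ ν hμν hμ hμ' hν hν'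
    exact Config.exists_perm_of_opposite_lines hc hg hc' hg' h0 hij hik hil hjk hjl hkl hl hl' hμν
      hμ hμ' hν hν'
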